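/- Let $k\ge 0$ be an integer. An infinitesimal noncommutative probability space of order $k$ is a pair $(\mathcal A,(\varphi^{(i)})_{0\le i\le k})$, where $\mathcal A$ is a unital algebra over $\mathbb C$ and $\varphi^{(i)}:\mathcal A\to\mathbb C$ are linear maps with $\varphi^{(0)}(1)=1$ and $\varphi^{(i)}(1)=0$ for $1\le i\le k$. For a finite set $X$ and $i\geq 0$ put $\Lambda_{X,i}=\{\lambda\in\mathbb N^X:\sum_{x}\lambda_x=i\}$, and $\Lambda_{l,i}=\Lambda_{\{1,\dots,l\},i}$. The infinitesimal non-crossing cumulant functionals $\kappa_n^{(i)}:\mathcal A^n\to\mathbb C$ ($n\ge1$, $0\le i\le k$) are the functionals uniquely determined by $$\sum_{p\in NC(n)}\ \sum_{\lambda\in\Lambda_{p,i}}\frac{i!}{\prod_{V\in p}\lambda_V!}\ \prod_{V\in p}\kappa^{(\lambda_V)}_{|V|}\big((a_1,\dots,a_n)|V\big)=\varphi^{(i)}(a_1\cdots a_n)$$ for all $n\geq 1$, $0\le i\le k$, $a_1,\dots,a_n\in\mathcal A$, where $NC(n)$ is the set of non-crossing partitions $p$ of $\{1<\dots<n\}$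 (each regarded as its set of blocks) and $(a_1,\dots,a_n)|V=(a_{v_1},\dots,a_{v_m})$ for $V=\{v_1<\dots<v_m\}$. Subsets $\mathcal M_1,\dots,\mathcal M_n\subseteq\mathcal A$ are infinitesimally free of order $k$ if $\kappa_m^{(i)}(a_1,\dots,a_m)=0$ for all $0\le i\le k$ whenever $a_1\in\mathcal M_{i_1},\dots,a_m\in\mathcal M_{i_m}$ and $i_s\ne i_t$ for some $s<t$. **Theorem.** Let $(\mathcal A,(\varphi^{(i)})_{0\le i\le k})$ be an infinitesimal noncommutative probability space of order $k$, let $\mathcal A_1,\dots,\mathcal A_n$ be unital subalgebras of $\mathcal A$, and let $K\subseteq\mathbb R$ have $0$ as an accumulation point (for instance $K=\mathbb R$). For $t\in\mathbb R$ put $\varphi_t=\sum_{i=0}^k\frac{t^i}{i!}\varphi^{(i)}$. Then $\mathcal A_1,\dots,\mathcal A_n$ are infinitesimally free of order $k$ if and only if, for every $l\ge1$ and all $a_1\in\mathcal A_{i_1},\dots,a_l\in\mathcal A_{i_l}$ with $i_1\ne i_2,\ i_2\neq i_3,\ \dots,\ i_{l-1}\ne i_l$, $$\varphi_t\big((a_1-\varphi_t(a_1)1)\cdots(a_l-\varphi_t(a_l)1)\big)=o(t^k)\qquad(t\to0,\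 t\in K\setminus\{0\}).\tag{1}$$ Moreover, for every $l\ge1$ and all $a_1,\dots,a_l\in\mathcal A$, condition (1) is equivalent to the $k+1$ identities $$\sum_{j=0}^i\ \sum_{\lambda\in\Lambda_{l,i-j}}(-1)^{\#\{m:\lambda_m>0\}}\,\frac{i!}{j!\,\lambda_1!\cdots\lambda_l!}\ \varphi^{(j)}\big(\hat\varphi^{(\lambda_1)}(a_1)\cdots\hat\varphi^{(\lambda_l)}(a_l)\big)=0,\qquad 0\le i\le k,\tag{2}$$ where $\hat\varphi^{(0)}(a)=a-\varphi^{(0)}(a)1$ and $\hat\varphi^{(r)}(a)=\varphi^{(r)}(a)1$ for $r\ge1$. Consequently $\mathcal A_1,\dots,\mathcal A_n$ are infinitesimally free of order $k$ if and only if (2) holds for every $l\ge1$ and all $a_1\in\mathcal A_{i_1},\dots,a_l\in\mathcal A_{i_l}$ with $i_1\ne i_2,\ \dots,\ i_{l-1}\ne i_l$. -/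

import Mathlib

open Finset Filter Topology Asymptotics
open scoped Nat

noncomputable section

/-- A partition of `{0 < 1 < ⋯ < n - 1}` is non-crossing if `a < b < c < d`, `a ∼ c`, `b ∼ d`
imply `a ∼ b`. -/
def IsNonCrossing {n : ℕ} (p : Finpartition (univ : Finset (Fin n))) : Prop :=
  ∀ a b c d : Fin n, a < b → b < c → c < d →
    ∀ V ∈ p.parts, ∀ W ∈ p.parts, a ∈ V → c ∈ V → b ∈ W → d ∈ W → V = W

instance {n : ℕ} (p : Finpartition (univ : Finset (Fin n))) : Decidable (IsNonCrossing p) := by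
  unfold IsNonCrossing
  infer_instance

/-- The finite set of non-crossing partitions of an `n`-element chain. -/
def NC (n : ℕ) : Finset (Finpartition (univ : Finset (Fin n))) :=
  univ.filter fun p => IsNonCrossing p

/-- The tuple `(a₁, …, aₙ) ∣ V`: the entries with index in `V`, in increasing order. -/
def restrictTuple {A : Type*} {n : ℕ} (a : Fin n → A) (V : Finset (Fin n)) : Fin V.card → A :=
  fun j => a (V.orderEmbOfFin rfl j)

/-- The set of families `(lam_x)_{x ∈ X}` of natural numbers with sum `i`. Since only `i ≤ k` is
relevant, all entries are at most `k`, and they are recorded as elements of `{0, …, k}`. -/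
def weakCompositions (k : ℕ) (X : Type*) [Fintype X] [DecidableEq X] (i : ℕ) : Finset (X → Fin (k + 1)) :=
  univ.filter fun lam => ∑ x, (lam x : ℕ) = i

/-- A block of a partition other than the one-block partition is smaller than the whole set. -/
theorem block_card_lt {n : ℕ} (p : Finpartition (univ : Finset (Fin n))) (hp : p.parts ≠ {univ})
    {V : Finset (Fin n)} (hV : V ∈ p.parts) : V.card < n := by
  by_contra hcard
  have h : V = univ := by
    apply Finset.eq_univ_of_card
    have := V.card_le_univ
    simp only [Fintype.card_fin] at this ⊢
    omega
  subst h
  apply hp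
  refine Finset.eq_singleton_iff_unique_mem.2 ⟨hV, fun W hW => ?_⟩
  by_contra hWu
  have hd : Disjoint W univ := p.disjoint hW hV hWu
  rw [← Finset.top_eq_univ] at hd
  exact p.bot_notMem (disjoint_top.1 hd ▸ hW)

theorem apply_restrictTuple_univ {A : Type*} (κ : (n : ℕ) → (Fin n → A) → ℂ) {n : ℕ} (a : Fin n → A) :
    κ (univ : Finset (Fin n)).card (restrictTuple a univ) = κ n a := by
  have key : ∀ (m : ℕ) (h : (univ : Finset (Fin n)).card = m), m = n →
      κ m (fun j => a ((univ : Finset (Fin n)).orderEmbOfFin h j)) = κ n a := by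
    intro m h hm
    subst hm
    have := Finset.orderEmbOfFin_unique h (f := id) (fun x => Finset.mem_univ x) strictMono_id
    congr 1
    funext j
    rw [← this]
    rfl
  exact key _ rfl (by simp)

/-- An infinitesimal noncommutative probability space of order `k` on the unital complex
algebra `A`. -/
structure InfNCProbSpace (k : ℕ) (A : Type*) [Ring A] [Algebra ℂ A] where
  /-- the functionals `φ⁽⁰⁾, …, φ⁽ᵏ⁾` -/
  phi : Fin (k + 1) → A →ₗ[ℂ] ℂ
  phi_zero_one : phi 0 1 = 1
  phi_one : ∀ i, i ≠ 0 → phi i 1 = 0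

namespace InfNCProbSpace

variable {k : ℕ} {A : Type*} [Ring A] [Algebra ℂ A]

/-- The infinitesimal non-crossing cumulant functionals `κₙ⁽ⁱ⁾` of order `k`, obtained by solving
the infinitesimal free moment-cumulant formula for the term of the one-block partition. The families
`lam` are indexed by the blocks of the partition. See `moment_cumulant` for the formula itself and
`cumulant_unique` for the fact that it determines these functionals. -/
def cumulant (P : InfNCProbSpace k A) (n : ℕ) (i : Fin (k + 1)) (a : Fin n → A) : ℂ :=
  P.phi i (List.ofFn a).prod -
    ∑ p : {p : Finpartition (univ : Finset (Fin n)) // p ∈ NC n ∧ p.parts ≠ {univ}},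
      ∑ lam ∈ weakCompositions k {V // V ∈ p.1.parts} (i : ℕ),
        (((i : ℕ)! : ℂ) / ∏ V : {V // V ∈ p.1.parts}, ((lam V : ℕ)! : ℂ)) *
          ∏ V : {V // V ∈ p.1.parts}, cumulant P V.1.card (lam V) (restrictTuple a V.1)
termination_by n
decreasing_by exact block_card_lt p.1 p.2.2 V.2

/-- `κ_p^{(lam)}(a₁, …, aₙ)` summed with multinomial weights over all non-crossing `p` and all
`lam` with sum `i`: the left-hand side of the infinitesimal free moment-cumulant formula. -/
def cumulantSum (κ : (n : ℕ) → Fin (k + 1) → (Fin n → A) → ℂ)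
    (n : ℕ) (i : Fin (k + 1)) (a : Fin n → A) : ℂ :=
  ∑ p ∈ NC n, ∑ lam ∈ weakCompositions k {V // V ∈ p.parts} (i : ℕ),
    (((i : ℕ)! : ℂ) / ∏ V : {V // V ∈ p.parts}, ((lam V : ℕ)! : ℂ)) *
      ∏ V : {V // V ∈ p.parts}, κ V.1.card (lam V) (restrictTuple a V.1)

/-- The sum over non-crossing partitions, with the term of the one-block partition split off. -/
theorem cumulantSum_eq (κ : (n : ℕ) → Fin (k + 1) → (Fin n → A) → ℂ)
    {n : ℕ} (hn : 0 < n) (i : Fin (k + 1)) (a : Fin n → A) :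
    cumulantSum κ n i a = κ n i a +
      ∑ p : {p : Finpartition (univ : Finset (Fin n)) // p ∈ NC n ∧ p.parts ≠ {univ}},
        ∑ lam ∈ weakCompositions k {V // V ∈ p.1.parts} (i : ℕ),
          (((i : ℕ)! : ℂ) / ∏ V : {V // V ∈ p.1.parts}, ((lam V : ℕ)! : ℂ)) *
            ∏ V : {V // V ∈ p.1.parts}, κ V.1.card (lam V) (restrictTuple a V.1) := by
  have hne : (univ : Finset (Fin n)) ≠ ⊥ := by
    rw [Finset.bot_eq_empty]
    exact (Finset.univ_nonempty_iff.2 ⟨⟨0, hn⟩⟩).ne_empty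
  set q : Finpartition (univ : Finset (Fin n)) := Finpartition.indiscrete hne with hq
  have hparts : q.parts = {univ} := rfl
  have hmem : q ∈ NC n := by
    refine Finset.mem_filter.2 ⟨Finset.mem_univ _, ?_⟩
    intro x y z w _ _ _ V hV W hW _ _ _ _
    rw [hparts, Finset.mem_singleton] at hV hW
    rw [hV, hW]
  unfold cumulantSum
  rw [← Finset.add_sum_erase _ _ hmem]
  congr 1
  · let V₀ : {V // V ∈ q.parts} := ⟨univ, by rw [hparts]; exact Finset.mem_singleton_self _⟩
    have hV₀ : ∀ V : {V // V ∈ q.parts}, V = V₀ := fun V =>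
      Subtype.ext (Finset.mem_singleton.1 V.2)
    have huniv : (univ : Finset {V // V ∈ q.parts}) = {V₀} :=
      Finset.eq_singleton_iff_unique_mem.2 ⟨Finset.mem_univ _, fun V _ => hV₀ V⟩
    have hw : weakCompositions k {V // V ∈ q.parts} (i : ℕ) = {fun _ => i} := by
      ext lam
      simp only [weakCompositions, Finset.mem_filter, Finset.mem_univ, true_and, huniv,
        Finset.sum_singleton, Finset.mem_singleton]
      constructor
      · intro h
        funext V
        rw [hV₀ V]
        exact Fin.ext h
      · rintro rfl
        rfl
    rw [hw, Finset.sum_singleton, huniv, Finset.prod_singleton, Finset.prod_singleton,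
      div_self (Nat.cast_ne_zero.2 (Nat.factorial_ne_zero _)), one_mul]
    exact apply_restrictTuple_univ (fun n => κ n i) a
  · refine Finset.sum_subtype _ (fun p => ?_) _
    rw [Finset.mem_erase, and_comm]
    refine and_congr_right fun _ => not_congr ⟨fun h => by rw [h, hparts], fun h => ?_⟩
    exact Finpartition.ext (by rw [h, hparts])

/-- The infinitesimal free moment-cumulant formula. -/
theorem moment_cumulant (P : InfNCProbSpace k A) {n : ℕ} (hn : 0 < n) (i : Fin (k + 1))
    (a : Fin n → A) : cumulantSum P.cumulant n i a = P.phi i (List.ofFn a).prod := by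
  rw [cumulantSum_eq _ hn, cumulant]
  ring

/-- The infinitesimal free moment-cumulant formula determines the cumulant functionals. -/
theorem cumulant_unique (P : InfNCProbSpace k A) (κ : (n : ℕ) → Fin (k + 1) → (Fin n → A) → ℂ)
    (hκ : ∀ n, 0 < n → ∀ (i : Fin (k + 1)) (a : Fin n → A),
      cumulantSum κ n i a = P.phi i (List.ofFn a).prod)
    (n : ℕ) (hn : 0 < n) (i : Fin (k + 1)) (a : Fin n → A) : κ n i a = P.cumulant n i a := by
  induction n using Nat.strong_induction_on generalizing i with
  | _ n ih =>
    have h := hκ n hn i a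
    rw [cumulantSum_eq κ hn] at h
    rw [cumulant, ← h, eq_sub_iff_add_eq]
    congr 1
    refine Finset.sum_congr rfl fun p _ => Finset.sum_congr rfl fun lam _ => ?_
    congr 1
    refine Finset.prod_congr rfl fun V _ => (ih _ (block_card_lt p.1 p.2.2 V.2) ?_ _ _).symm
    exact Finset.card_pos.2 (p.1.nonempty_of_mem_parts V.2)

/-- Vanishing of mixed infinitesimal cumulants: the definition of infinitesimal freeness of
order `k` of the subsets `M 0, …, M (n - 1)`. -/
def IsInfFree (P : InfNCProbSpace k A) {n : ℕ} (M : Fin n → Set A) : Prop :=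
  ∀ (m : ℕ) (ι : Fin m → Fin n) (a : Fin m → A), (∀ s, a s ∈ M (ι s)) →
    (∃ s t, s < t ∧ ι s ≠ ι t) → ∀ i : Fin (k + 1), P.cumulant m i a = 0

/-- `φ_t = ∑_{i ≤ k} (tⁱ / i!) φ⁽ⁱ⁾`. -/
def phit (P : InfNCProbSpace k A) (t : ℝ) : A →ₗ[ℂ] ℂ :=
  ∑ i : Fin (k + 1), ((t : ℂ) ^ (i : ℕ) / ((i : ℕ)! : ℂ)) • P.phi i

/-- `φ_t((a₁ - φ_t(a₁)) ⋯ (a_l - φ_t(a_l)))`. -/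
def centeredMoment (P : InfNCProbSpace k A) {l : ℕ} (a : Fin l → A) (t : ℝ) : ℂ :=
  P.phit t (List.ofFn fun m => a m - algebraMap ℂ A (P.phit t (a m))).prod

/-- `a - φ⁽⁰⁾(a) 1` for `r = 0`, and `φ⁽ʳ⁾(a) 1` for `r > 0`. -/
def phihat (P : InfNCProbSpace k A) (r : Fin (k + 1)) (a : A) : A :=
  if r = 0 then a - algebraMap ℂ A (P.phi 0 a) else algebraMap ℂ A (P.phi r a)

/-- The left-hand side of the `i`-th moment identity: the sum over `j ≤ i` and over
`lam₁ + ⋯ + lam_l = i - j` of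
`(-1)^#{m | lam_m > 0} * i! / (j! lam₁! ⋯ lam_l!) * φ⁽ʲ⁾(phihat lam₁ a₁ ⋯ phihat lam_l a_l)`. -/
def momentExpr (P : InfNCProbSpace k A) {l : ℕ} (a : Fin l → A) (i : Fin (k + 1)) : ℂ :=
  ∑ j ∈ Finset.Iic i, ∑ lam ∈ weakCompositions k (Fin l) ((i : ℕ) - (j : ℕ)),
    (-1 : ℂ) ^ (univ.filter fun m => 0 < lam m).card *
      (((i : ℕ)! : ℂ) / (((j : ℕ)! : ℂ) * ∏ m, ((lam m : ℕ)! : ℂ))) *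
        P.phi j (List.ofFn fun m => P.phihat (lam m) (a m)).prod

end InfNCProbSpace

end

/-! Infinitesimal freeness of order `k` is ordinary freeness over the ring `R = ℂ[X]/(X^(k+1))`. Put
`φ = ∑ Xⁱ/i! φ⁽ⁱ⁾` and `κ = ∑ Xⁱ/i! κ⁽ⁱ⁾`, with values in `R`. The weights `i!/∏ λ_V!` are those
that arise from multiplying exponential generating polynomials, so `κ` satisfies the ordinary free
moment-cumulant formula for `φ` (`InfNCProbSpace.isFreeCumulant`), and `κ` vanishes on a tuple iff
all `κ⁽ⁱ⁾` do. The centered moment of `φ_t` is the value at `t` of a polynomial. It is `o(tᵏ)` iff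
the coefficients of degree at most `k` vanish (`isLittleO_eval_iff`), that is, iff its class in `R`
is zero; up to the factor `i!` these coefficients are the moment expressions (`coeff_centeredPoly`).
What remains holds over any commutative ring (`IsFreeCumulant.mixedVanish_iff`): mixed cumulants
vanish iff alternating centered moments do. Centering deletes the partitions with a one-element
block (`centeredExpansion_eq`). Each remaining non-crossing partition has a block with two
neighbours (`exists_adjacent`), whose cumulant is mixed if the tuple alternates. So vanishing mixed
cumulants kill every term. Conversely, by induction on the length, only the full cumulant survives
for an alternating tuple. For a tuple with two neighbours in one algebra, multiply them and use the
formula for cumulants with a product as an entry (`blockValue_mul`). -/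

noncomputable section

/-! ### Non-crossing partitions of a finite subset of a chain -/

/-- `P` is the set of blocks of a non-crossing partition of `S`. -/
structure IsNCPartition {α : Type*} [LinearOrder α] (S : Finset α) (P : Finset (Finset α)) :
    Prop where
  nonempty : ∀ V ∈ P, V.Nonempty
  cover : ∀ x, x ∈ S ↔ ∃ V ∈ P, x ∈ V
  eq_of_mem : ∀ V ∈ P, ∀ W ∈ P, ∀ x, x ∈ V → x ∈ W → V = W
  noncrossing : ∀ a b c d : α, a < b → b < c → c < d →
    ∀ V ∈ P, ∀ W ∈ P, a ∈ V → c ∈ V → b ∈ W → d ∈ W → V = W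

namespace IsNCPartition

variable {α : Type*} [LinearOrder α] {S : Finset α}

theorem subset {P : Finset (Finset α)} (h : IsNCPartition S P) {V : Finset α} (hV : V ∈ P) : V ⊆ S :=
  fun x hx => (h.cover x).2 ⟨V, hV, hx⟩

theorem singleton (hS : S.Nonempty) : IsNCPartition S {S} := by
  constructor <;> simp_all

theorem ssubset {P : Finset (Finset α)} (h : IsNCPartition S P) (hP : P ≠ {S}) {V : Finset α} (hV : V ∈ P) : V ⊂ S := by
  refine (h.subset hV).ssubset_of_ne ?_
  rintro rfl
  refine hP (Finset.eq_singleton_iff_unique_mem.2 ⟨hV, fun W hW => ?_⟩)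
  obtain ⟨x, hx⟩ := h.nonempty W hW
  exact h.eq_of_mem _ hW _ hV x hx (h.subset hW hx)

theorem not_cross {P : Finset (Finset α)} (h : IsNCPartition S P) {V W : Finset α}
    (hV : V ∈ P) (hW : W ∈ P) (hne : V ≠ W) {a b c d : α} (h1 : a < b) (h2 : b < c) (h3 : c < d) (ha : a ∈ V) (hc : c ∈ V)
    (hb : b ∈ W) (hd : d ∈ W) : False :=
  hne (h.noncrossing a b c d h1 h2 h3 V hV W hW ha hc hb hd)

end IsNCPartition

/-! ### Sums over non-crossing partitions; removal of one-element blocks -/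

section

variable {α : Type*} [LinearOrder α] {R : Type*} [CommRing R]

open scoped Classical in
/-- The non-crossing partitions of `S`, given by their sets of blocks. -/
def ncPartitions (S : Finset α) : Finset (Finset (Finset α)) :=
  S.powerset.powerset.filter (IsNCPartition S)

theorem mem_ncPartitions {S : Finset α} {P : Finset (Finset α)} :
    P ∈ ncPartitions S ↔ IsNCPartition S P := by
  simp only [ncPartitions, mem_filter, mem_powerset, and_iff_right_iff_imp]
  exact fun h V hV => mem_powerset.2 (h.subset hV)

/-- The multiplicative extension of `g`, summed over the non-crossing partitions of `S`. -/
def ncSum (g : Finset α → R) (S : Finset α) : R :=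
  ∑ P ∈ ncPartitions S, ∏ V ∈ P, g V

theorem ncSum_congr {g h : Finset α → R} {S : Finset α}
    (H : ∀ V ⊆ S, V.Nonempty → g V = h V) : ncSum g S = ncSum h S :=
  sum_congr rfl fun _ hP => prod_congr rfl fun V hV =>
    H V ((mem_ncPartitions.1 hP).subset hV) ((mem_ncPartitions.1 hP).nonempty V hV)

theorem ncSum_empty (g : Finset α → R) : ncSum g ∅ = 1 := by
  have : ncPartitions (∅ : Finset α) = {∅} := by
    ext P
    simp only [mem_ncPartitions, mem_singleton]
    constructor
    · intro h
      refine eq_empty_of_forall_notMem fun V hV => ?_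
      obtain ⟨x, hx⟩ := h.nonempty V hV
      exact notMem_empty x (h.subset hV hx)
    · rintro rfl
      constructor <;> simp
  simp [ncSum, this]

theorem ncSum_eq_add (g : Finset α → R) {S : Finset α} (hS : S.Nonempty) :
    ncSum g S = g S + ∑ P ∈ (ncPartitions S).erase {S}, ∏ V ∈ P, g V := by
  rw [ncSum, ← add_sum_erase _ _ (mem_ncPartitions.2 (.singleton hS)), prod_singleton]

/-- A function on blocks is determined by its sums over non-crossing partitions. -/
theorem eq_of_ncSum_eq {g h : Finset α → R} (S : Finset α) (hS : S.Nonempty)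
    (H : ∀ T ⊆ S, T.Nonempty → ncSum g T = ncSum h T) : g S = h S := by
  induction S using Finset.strongInduction with
  | H S ih =>
    have h1 := H S Subset.rfl hS
    rw [ncSum_eq_add _ hS, ncSum_eq_add _ hS] at h1
    refine add_right_cancel (h1.trans ?_)
    congr 1
    refine sum_congr rfl fun P hP => prod_congr rfl fun V hV => ?_
    rw [mem_erase, mem_ncPartitions] at hP
    have hVS := hP.2.ssubset hP.1 hV
    exact (ih V hVS (hP.2.nonempty V hV) fun T hT => H T (hT.trans hVS.subset)).symm

/-- Deleting a one-element block. -/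
theorem IsNCPartition.erase_singleton {S : Finset α} {P : Finset (Finset α)} {m : α}
    (h : IsNCPartition S P) (hm : {m} ∈ P) : IsNCPartition (S.erase m) (P.erase {m}) where
  nonempty V hV := h.nonempty V (mem_of_mem_erase hV)
  cover x := by
    have := h.cover x
    have h2 := h.eq_of_mem {m} hm
    constructor
    · intro hx
      rw [mem_erase] at hx
      obtain ⟨V, hV, hxV⟩ := this.1 hx.2
      refine ⟨V, mem_erase.2 ⟨?_, hV⟩, hxV⟩
      rintro rfl
      exact hx.1 (mem_singleton.1 hxV)
    · rintro ⟨V, hV, hxV⟩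
      rw [mem_erase] at hV ⊢
      refine ⟨?_, this.2 ⟨V, hV.2, hxV⟩⟩
      rintro rfl
      exact hV.1 (h2 V hV.2 x (mem_singleton_self x) hxV).symm
  eq_of_mem V hV W hW := h.eq_of_mem V (mem_of_mem_erase hV) W (mem_of_mem_erase hW)
  noncrossing a b c d h1 h2 h3 V hV W hW :=
    h.noncrossing a b c d h1 h2 h3 V (mem_of_mem_erase hV) W (mem_of_mem_erase hW)

/-- Adding a one-element block. -/
theorem IsNCPartition.insert_singleton {S : Finset α} {P : Finset (Finset α)} {m : α}
    (hm : m ∈ S) (h : IsNCPartition (S.erase m) P) : IsNCPartition S (insert {m} P) := by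
  have key : ∀ V ∈ P, m ∉ V := fun V hV hmV => notMem_erase m S (h.subset hV hmV)
  constructor
  · intro V hV
    rcases mem_insert.1 hV with rfl | hV
    · exact singleton_nonempty m
    · exact h.nonempty V hV
  · intro x
    have := h.cover x
    rw [mem_erase] at this
    simp only [mem_insert, exists_eq_or_imp, mem_singleton, ← this]
    constructor
    · tauto
    · rintro (rfl | h)
      exacts [hm, h.2]
  · intro V hV W hW x hxV hxW
    rcases mem_insert.1 hV with rfl | hV <;> rcases mem_insert.1 hW with rfl | hW
    · rfl
    · exact absurd (mem_singleton.1 hxV ▸ hxW) (key W hW)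
    · exact absurd (mem_singleton.1 hxW ▸ hxV) (key V hV)
    · exact h.eq_of_mem V hV W hW x hxV hxW
  · intro a b c d h1 h2 h3 V hV W hW ha hc hb hd
    rcases mem_insert.1 hV with rfl | hV
    · rw [mem_singleton] at ha hc
      exact absurd (ha.trans hc.symm) (h1.trans h2).ne
    rcases mem_insert.1 hW with rfl | hW
    · rw [mem_singleton] at hb hd
      exact absurd (hb.trans hd.symm) (h2.trans h3).ne
    exact h.noncrossing a b c d h1 h2 h3 V hV W hW ha hc hb hd

/-- A one-element block crosses nothing, so the partitions of `S` having `{m}` as a block are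
exactly the partitions of `S.erase m` with `{m}` added. Setting `g {m}` to zero deletes their terms.
-/
theorem ncSum_update_singleton (g : Finset α → R) {S : Finset α} {m : α} (hm : m ∈ S) :
    ncSum (Function.update g {m} 0) S = ncSum g S - g {m} * ncSum g (S.erase m) := by
  have h1 : ∑ P ∈ ncPartitions S with {m} ∈ P, ∏ V ∈ P, g V = g {m} * ncSum g (S.erase m) := by
    rw [ncSum, mul_sum]
    refine sum_bij' (fun P _ => P.erase {m}) (fun P _ => insert {m} P) ?_ ?_ ?_ ?_ ?_
    · intro P hP
      rw [mem_filter, mem_ncPartitions] at hP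
      exact mem_ncPartitions.2 (hP.1.erase_singleton hP.2)
    · intro P hP
      rw [mem_filter, mem_ncPartitions]
      exact ⟨.insert_singleton hm (mem_ncPartitions.1 hP), mem_insert_self _ _⟩
    · intro P hP
      exact insert_erase (mem_filter.1 hP).2
    · intro P hP
      refine erase_insert fun h => ?_
      exact notMem_erase m S ((mem_ncPartitions.1 hP).subset h (mem_singleton_self m))
    · intro P hP
      exact (mul_prod_erase P g (mem_filter.1 hP).2).symm
  rw [← h1, ncSum, ncSum, ← sum_filter_add_sum_filter_not _ (fun P => {m} ∈ P),
    ← sum_filter_add_sum_filter_not (ncPartitions S) (fun P => {m} ∈ P) fun P => ∏ V ∈ P, g V,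
    add_sub_cancel_left, sum_eq_zero, zero_add]
  · refine sum_congr rfl fun P hP => prod_congr rfl fun V hV => ?_
    rw [Function.update_of_ne]
    rintro rfl
    exact (mem_filter.1 hP).2 hV
  · intro P hP
    exact prod_eq_zero (mem_filter.1 hP).2 (Function.update_self ..)

open scoped Classical in
/-- Removing the contributions of one-element blocks inside `U` by inclusion-exclusion. -/
theorem ncSum_remove_singletons (g : Finset α → R) (U : Finset α) :
    ∀ S, U ⊆ S → ncSum (fun V => if ∃ m ∈ U, V = {m} then 0 else g V) S =
      ∑ T ∈ U.powerset, (∏ m ∈ T, -g {m}) * ncSum g (S \ T) := by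
  -- `S` must stay general: splitting off `{m}` leaves a sum over `S.erase m`, to which the
  -- induction hypothesis is applied as well.
  induction U using Finset.induction_on with
  | empty => simp
  | insert m U hmU ih =>
    intro S hS
    obtain ⟨hm, hU⟩ := insert_subset_iff.1 hS
    have e : (fun V => if ∃ x ∈ insert m U, V = {x} then 0 else g V) =
        Function.update (fun V => if ∃ x ∈ U, V = {x} then 0 else g V) {m} 0 := by
      funext V
      by_cases hV : V = {m}
      · simp [hV]
      · simp [hV]
    rw [e, ncSum_update_singleton _ hm, ih S hU,
      ih (S.erase m) (fun x hx => mem_erase.2 ⟨fun h => hmU (h ▸ hx), hU hx⟩),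
      sum_powerset_insert hmU, sub_eq_add_neg, mul_sum, ← sum_neg_distrib]
    congr 1
    refine sum_congr rfl fun T hT => ?_
    have hmT : m ∉ T := fun h => hmU (mem_powerset.1 hT h)
    rw [prod_insert hmT, if_neg (by simpa using hmU)]
    have : S.erase m \ T = S \ insert m T := by
      ext x; simp only [Finset.mem_sdiff, mem_erase, mem_insert]; tauto
    rw [this]; ring

end

/-! ### Merging two neighbouring points -/

section

variable {α : Type*} [LinearOrder α] {R : Type*} [CommRing R]

/-- The blocks meeting `{j, j'}`. -/
def blocksAt (j j' : α) (P : Finset (Finset α)) : Finset (Finset α) :=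
  P.filter fun W => j ∈ W ∨ j' ∈ W

/-- The union of the blocks in `P`, without `j'`. -/
def mergedBlock (j' : α) (P : Finset (Finset α)) : Finset α :=
  (P.biUnion id).erase j'

/-- Split the block `V` of `q` into the blocks in `r`. -/
def splitBlock (V : Finset α) (q r : Finset (Finset α)) : Finset (Finset α) :=
  q.erase V ∪ r

/-- Merge the blocks meeting `{j, j'}` and delete `j'`. -/
def mergeBlocks (j j' : α) (P : Finset (Finset α)) : Finset (Finset α) :=
  insert (mergedBlock j' (blocksAt j j' P)) (P \ blocksAt j j' P)

theorem IsNCPartition.split {j j' : α} (hj : j ⋖ j') {T V : Finset α} {q r : Finset (Finset α)}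
    (hT : j' ∉ T) (hV : V ∈ q) (hjV : j ∈ V)
    (hq : IsNCPartition T q) (hr : IsNCPartition (insert j' V) r) :
    IsNCPartition (insert j' T) (splitBlock V q r) := by
  have hlt := hj.lt
  have hgap : ∀ x, x ≤ j ∨ j' ≤ x := fun x => by
    by_contra! h
    exact hj.2 h.1 h.2
  have hdisj : ∀ A ∈ q, A ≠ V → ∀ x ∈ A, x ∉ V ∧ x ≠ j ∧ x ≠ j' := fun A hA hne x hx => by
    have h1 : x ∉ V := fun h => hne (hq.eq_of_mem A hA V hV x hx h)
    refine ⟨h1, ?_, ?_⟩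
    · rintro rfl; exact h1 hjV
    · rintro rfl; exact hT (hq.subset hA hx)
  have hsub : ∀ W ∈ r, ∀ x ∈ W, x = j' ∨ x ∈ V := fun W hW x hx => by
    simpa using hr.subset hW hx
  have hTV := hq.subset hV
  have hmem : ∀ A, A ∈ splitBlock V q r ↔ (A ≠ V ∧ A ∈ q) ∨ A ∈ r := fun A => by
    simp [splitBlock]
  constructor
  · intro A hA
    rcases (hmem A).1 hA with hA | hA
    · exact hq.nonempty A hA.2
    · exact hr.nonempty A hA
  · intro x
    have c1 := hq.cover x
    have c2 := hr.cover x
    simp only [mem_insert] at c2 ⊢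
    constructor
    · intro hx
      by_cases h : x = j' ∨ x ∈ V
      · obtain ⟨W, hW, hxW⟩ := c2.1 h
        exact ⟨W, (hmem W).2 (Or.inr hW), hxW⟩
      · obtain ⟨W, hW, hxW⟩ := c1.1 (by tauto)
        refine ⟨W, (hmem W).2 (Or.inl ⟨?_, hW⟩), hxW⟩
        rintro rfl; tauto
    · rintro ⟨W, hW, hxW⟩
      rcases (hmem W).1 hW with hW | hW
      · exact Or.inr (hq.subset hW.2 hxW)
      · rcases hsub W hW x hxW with h | h
        · exact Or.inl h
        · exact Or.inr (hTV h)
  · intro A hA B hB x hxA hxB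
    rcases (hmem A).1 hA with hA | hA <;> rcases (hmem B).1 hB with hB | hB
    · exact hq.eq_of_mem A hA.2 B hB.2 x hxA hxB
    · have := hdisj A hA.2 hA.1 x hxA
      have := hsub B hB x hxB
      tauto
    · have := hdisj B hB.2 hB.1 x hxB
      have := hsub A hA x hxA
      tauto
    · exact hr.eq_of_mem A hA B hB x hxA hxB
  · intro a b c d h1 h2 h3 A hA B hB ha hc hb hd
    -- replacing `j'` by `j` does not change the order relative to the other elements
    have repl : ∀ W ∈ r, ∀ x ∈ W, ∃ y ∈ V, (y = x ∨ (y = j ∧ x = j')) := fun W hW x hx => by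
      rcases hsub W hW x hx with h | h
      · exact ⟨j, hjV, Or.inr ⟨rfl, h⟩⟩
      · exact ⟨x, h, Or.inl rfl⟩
    rcases (hmem A).1 hA with hA | hA <;> rcases (hmem B).1 hB with hB | hB
    · exact hq.noncrossing a b c d h1 h2 h3 A hA.2 B hB.2 ha hc hb hd
    · exfalso
      obtain ⟨b', hb', hbb⟩ := repl B hB b hb
      obtain ⟨d', hd', hdd⟩ := repl B hB d hd
      have ha' := hdisj A hA.2 hA.1 a ha
      have hc' := hdisj A hA.2 hA.1 c hc
      have := hgap a
      have := hgap c
      exact hq.not_cross hA.2 hV hA.1 (a := a) (b := b') (c := c) (d := d')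
        (by grind) (by grind) (by grind) ha hc hb' hd'
    · exfalso
      obtain ⟨a', haV, haa⟩ := repl A hA a ha
      obtain ⟨c', hcV, hcc⟩ := repl A hA c hc
      have hb' := hdisj B hB.2 hB.1 b hb
      have hd' := hdisj B hB.2 hB.1 d hd
      have := hgap b
      have := hgap d
      exact hq.not_cross hV hB.2 hB.1.symm (a := a') (b := b) (c := c') (d := d)
        (by grind) (by grind) (by grind) haV hcV hb hd
    · exact hr.noncrossing a b c d h1 h2 h3 A hA B hB ha hc hb hd

theorem mem_mergedBlock_blocksAt {j j' x : α} {P : Finset (Finset α)} :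
    x ∈ mergedBlock j' (blocksAt j j' P) ↔ x ≠ j' ∧ ∃ W ∈ P, (j ∈ W ∨ j' ∈ W) ∧ x ∈ W := by
  simp [mergedBlock, blocksAt, and_assoc]

theorem IsNCPartition.merge {j j' : α} (hj : j ⋖ j') {T : Finset α} {P : Finset (Finset α)}
    (hjT : j ∈ T) (hT : j' ∉ T) (hP : IsNCPartition (insert j' T) P) :
    IsNCPartition T (mergeBlocks j j' P) := by
  have hlt := hj.lt
  have hgap : ∀ x, x ≤ j ∨ j' ≤ x := fun x => by
    by_contra! h
    exact hj.2 h.1 h.2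
  obtain ⟨W₁, hW₁, hjW₁⟩ := (hP.cover j).1 (mem_insert_of_mem hjT)
  obtain ⟨W₂, hW₂, hjW₂⟩ := (hP.cover j').1 (mem_insert_self _ _)
  set U := mergedBlock j' (blocksAt j j' P) with hU
  have hUmem : ∀ x, x ∈ U ↔ x ≠ j' ∧ (x ∈ W₁ ∨ x ∈ W₂) := fun x => by
    rw [hU, mem_mergedBlock_blocksAt]
    refine and_congr_right fun _ => ⟨?_, ?_⟩
    · rintro ⟨W, hW, h | h, hx⟩
      · exact Or.inl (hP.eq_of_mem W hW W₁ hW₁ j h hjW₁ ▸ hx)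
      · exact Or.inr (hP.eq_of_mem W hW W₂ hW₂ j' h hjW₂ ▸ hx)
    · rintro (h | h)
      exacts [⟨W₁, hW₁, Or.inl hjW₁, h⟩, ⟨W₂, hW₂, Or.inr hjW₂, h⟩]
  have hmem : ∀ A, A ∈ mergeBlocks j j' P ↔ A = U ∨ (A ∈ P ∧ j ∉ A ∧ j' ∉ A) := fun A => by
    simp only [mergeBlocks, blocksAt, mem_insert, Finset.mem_sdiff, mem_filter]
    tauto
  have hdisj : ∀ A ∈ P, j ∉ A → j' ∉ A → ∀ x ∈ A, x ∉ W₁ ∧ x ∉ W₂ ∧ x ≠ j ∧ x ≠ j' := by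
    intro A hA h1 h2 x hx
    refine ⟨fun h => h1 ?_, fun h => h2 ?_, fun h => h1 (h ▸ hx), fun h => h2 (h ▸ hx)⟩
    · rwa [hP.eq_of_mem A hA W₁ hW₁ x hx h]
    · rwa [hP.eq_of_mem A hA W₂ hW₂ x hx h]
  constructor
  · intro A hA
    rcases (hmem A).1 hA with rfl | hA
    · exact ⟨j, (hUmem j).2 ⟨hlt.ne, Or.inl hjW₁⟩⟩
    · exact hP.nonempty A hA.1
  · intro x
    have c := hP.cover x
    rw [mem_insert] at c
    constructor
    · intro hx
      obtain ⟨W, hW, hxW⟩ := c.1 (Or.inr hx)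
      have hxj : x ≠ j' := by rintro rfl; exact hT hx
      by_cases h : j ∈ W ∨ j' ∈ W
      · exact ⟨U, (hmem U).2 (Or.inl rfl), mem_mergedBlock_blocksAt.2 ⟨hxj, W, hW, h, hxW⟩⟩
      · exact ⟨W, (hmem W).2 (Or.inr (by tauto)), hxW⟩
    · rintro ⟨W, hW, hxW⟩
      rcases (hmem W).1 hW with rfl | hW
      · obtain ⟨h1, h2⟩ := (hUmem x).1 hxW
        rcases h2 with h2 | h2
        · exact (c.2 ⟨W₁, hW₁, h2⟩).resolve_left h1
        · exact (c.2 ⟨W₂, hW₂, h2⟩).resolve_left h1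
      · exact (c.2 ⟨W, hW.1, hxW⟩).resolve_left (hdisj W hW.1 hW.2.1 hW.2.2 x hxW).2.2.2
  · intro A hA B hB x hxA hxB
    rcases (hmem A).1 hA with rfl | hA <;> rcases (hmem B).1 hB with rfl | hB
    · rfl
    · have := hdisj B hB.1 hB.2.1 hB.2.2 x hxB
      have := (hUmem x).1 hxA
      tauto
    · have := hdisj A hA.1 hA.2.1 hA.2.2 x hxA
      have := (hUmem x).1 hxB
      tauto
    · exact hP.eq_of_mem A hA.1 B hB.1 x hxA hxB
  · have key : ∀ A ∈ P, j ∉ A → j' ∉ A → ∀ a c x y, a ∈ A → c ∈ A → x ∈ U → y ∈ U → a < x →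
        x < c → (y < a ∨ c < y) → False := by
      intro A hA h1 h2 a c x y ha hc hx hy hax hxc hyac
      have hne₁ : A ≠ W₁ := by rintro rfl; exact h1 hjW₁
      have hne₂ : A ≠ W₂ := by rintro rfl; exact h2 hjW₂
      have cross : ∀ W ∈ P, A ≠ W → ∀ u v, u ∈ W → v ∈ W → a < u → u < c → (v < a ∨ c < v) →
          False := by
        intro W hW hne u v hu hv h3 h4 h5
        rcases h5 with h5 | h5
        · exact hP.not_cross hW hA hne.symm h5 h3 h4 hv hu ha hc
        · exact hP.not_cross hA hW hne h3 h4 h5 ha hc hu hv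
      have c1 := cross W₁ hW₁ hne₁
      have c2 := cross W₂ hW₂ hne₂
      have ga := hgap a
      have gc := hgap c
      have na := hdisj A hA h1 h2 a ha
      have nc := hdisj A hA h1 h2 c hc
      have hx' := ((hUmem x).1 hx).2
      have hy' := ((hUmem y).1 hy).2
      -- `A` contains neither `j` nor `j'`, so these two lie on the same side of `a` and of `c`. If
      -- both lie between `a` and `c`, the old block of `y` already crosses `A`, with `j` or `j'` in
      -- the role of `x`. Otherwise the old block of `x` does, with `j` or `j'` in the role of `y`.
      by_cases hin : a < j ∧ j < c
      · have hin' : a < j' ∧ j' < c := ⟨hin.1.trans hlt, by grind⟩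
        rcases hy' with hy' | hy'
        · exact c1 j y hjW₁ hy' hin.1 hin.2 hyac
        · exact c2 j' y hjW₂ hy' hin'.1 hin'.2 hyac
      · rcases hx' with hx' | hx'
        · exact c1 x j hx' hjW₁ hax hxc (by grind)
        · exact c2 x j' hx' hjW₂ hax hxc (by grind)
    intro a b c d h1 h2 h3 A hA B hB ha hc hb hd
    rcases (hmem A).1 hA with rfl | hA <;> rcases (hmem B).1 hB with rfl | hB
    · rfl
    · exact (key B hB.1 hB.2.1 hB.2.2 b d c a hb hd hc ha h2 h3 (Or.inl h1)).elim
    · exact (key A hA.1 hA.2.1 hA.2.2 a c b d ha hc hb hd h1 h2 (Or.inr h3)).elim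
    · exact hP.noncrossing a b c d h1 h2 h3 A hA.1 B hB.1 ha hc hb hd

theorem IsNCPartition.blocksAt_mergedBlock {j j' : α} {T : Finset α}
    {P : Finset (Finset α)} (hP : IsNCPartition (insert j' T) P) :
    IsNCPartition (insert j' (mergedBlock j' (blocksAt j j' P))) (blocksAt j j' P) where
  nonempty V hV := hP.nonempty V (mem_filter.1 hV).1
  cover x := by
    obtain ⟨W₂, hW₂, hjW₂⟩ := (hP.cover j').1 (mem_insert_self _ _)
    rw [mem_insert, mem_mergedBlock_blocksAt]
    simp only [blocksAt, mem_filter]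
    constructor
    · rintro (rfl | ⟨_, W, hW, h, hx⟩)
      · exact ⟨W₂, ⟨hW₂, Or.inr hjW₂⟩, hjW₂⟩
      · exact ⟨W, ⟨hW, h⟩, hx⟩
    · rintro ⟨W, ⟨hW, h⟩, hx⟩
      by_cases hxj : x = j'
      · exact Or.inl hxj
      · exact Or.inr ⟨hxj, W, hW, h, hx⟩
  eq_of_mem V hV W hW := hP.eq_of_mem V (mem_filter.1 hV).1 W (mem_filter.1 hW).1
  noncrossing a b c d h1 h2 h3 V hV W hW :=
    hP.noncrossing a b c d h1 h2 h3 V (mem_filter.1 hV).1 W (mem_filter.1 hW).1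

open scoped Classical in
/-- The non-crossing partitions of `V ∪ {j'}` all of whose blocks meet `{j, j'}`: these have at
most two blocks. -/
def splitPartitions (j j' : α) (V : Finset α) : Finset (Finset (Finset α)) :=
  (ncPartitions (insert j' V)).filter fun r => ∀ W ∈ r, j ∈ W ∨ j' ∈ W

theorem mem_splitPartitions {j j' : α} {V : Finset α} {r : Finset (Finset α)} :
    r ∈ splitPartitions j j' V ↔
      IsNCPartition (insert j' V) r ∧ ∀ W ∈ r, j ∈ W ∨ j' ∈ W := by
  rw [splitPartitions, mem_filter, mem_ncPartitions]

/-- The multiplicative extension of `g`, summed over `splitPartitions j j' V`. -/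
def splitSum (g : Finset α → R) (j j' : α) (V : Finset α) : R :=
  ∑ r ∈ splitPartitions j j' V, ∏ W ∈ r, g W

/-- Cumulants with a product as an entry, on the level of sums over non-crossing partitions. -/
theorem ncSum_splitSum (g : Finset α → R) {j j' : α} (hj : j ⋖ j') {T : Finset α}
    (hjT : j ∈ T) (hT : j' ∉ T) :
    ncSum (fun V => if j ∈ V then splitSum g j j' V else g V) T = ncSum g (insert j' T) := by
  classical
  -- `b q` will be the block of `q` through `j`. It is chosen for every `q`, with the dummy value
  -- `∅` off the partitions of `T`, so that it can be used as a function in the bijection.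
  have blk : ∀ q : Finset (Finset α), ∃ V, IsNCPartition T q → V ∈ q ∧ j ∈ V := by
    intro q
    by_cases hq : IsNCPartition T q
    · obtain ⟨V, hV, hjV⟩ := (hq.cover j).1 hjT
      exact ⟨V, fun _ => ⟨hV, hjV⟩⟩
    · exact ⟨∅, fun h => absurd h hq⟩
  choose b hb using blk
  have step : ∀ q ∈ ncPartitions T,
      ∏ V ∈ q, (if j ∈ V then splitSum g j j' V else g V) =
        ∑ r ∈ splitPartitions j j' (b q),
          (∏ V ∈ q.erase (b q), g V) * ∏ W ∈ r, g W := by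
    intro q hq
    have hq' := mem_ncPartitions.1 hq
    obtain ⟨h1, h2⟩ := hb q hq'
    rw [← mul_prod_erase q _ h1, if_pos h2, ← mul_sum, mul_comm, splitSum]
    congr 1
    refine prod_congr rfl fun V hV => if_neg fun hjV => ?_
    rw [mem_erase] at hV
    exact hV.1 (hq'.eq_of_mem V hV.2 _ h1 j hjV h2)
  rw [ncSum, sum_congr rfl step, sum_sigma', ncSum]
  have notr : ∀ q r, IsNCPartition T q → IsNCPartition (insert j' (b q)) r →
      (∀ W ∈ r, j ∈ W ∨ j' ∈ W) → ∀ V ∈ q.erase (b q), j ∉ V ∧ j' ∉ V := by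
    intro q r hq hr hr' V hV
    rw [mem_erase] at hV
    refine ⟨fun h => hV.1 (hq.eq_of_mem V hV.2 _ (hb q hq).1 j h (hb q hq).2),
      fun h => hT (hq.subset hV.2 h)⟩
  -- A partition of `T ∪ {j'}` amounts to a pair: `r`, its blocks meeting `{j, j'}`, and `q`, the
  -- partition of `T` in which these are merged. The block of `q` through `j` is the union of `r`
  -- without `j'`.
  refine sum_bij' (fun x _ => splitBlock (b x.1) x.1 x.2)
    (fun P _ => ⟨mergeBlocks j j' P, blocksAt j j' P⟩) ?_ ?_ ?_ ?_ ?_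
  · rintro ⟨q, r⟩ hx
    simp only [mem_sigma, mem_splitPartitions, mem_ncPartitions] at hx ⊢
    exact IsNCPartition.split hj hT (hb q hx.1).1 (hb q hx.1).2 hx.1 hx.2.1
  · intro P hP
    simp only [mem_sigma, mem_splitPartitions, mem_ncPartitions] at hP ⊢
    have hm := hP.merge hj hjT hT
    have e : b (mergeBlocks j j' P) = mergedBlock j' (blocksAt j j' P) := by
      refine hm.eq_of_mem _ (hb _ hm).1 _ (mem_insert_self _ _) j (hb _ hm).2 ?_
      obtain ⟨W, hW, h⟩ := (hP.cover j).1 (mem_insert_of_mem hjT)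
      exact mem_mergedBlock_blocksAt.2 ⟨hj.lt.ne, W, hW, Or.inl h, h⟩
    rw [e]
    exact ⟨hm, hP.blocksAt_mergedBlock, fun W hW => (mem_filter.1 hW).2⟩
  · rintro ⟨q, r⟩ hx
    simp only [mem_sigma, mem_splitPartitions, mem_ncPartitions] at hx
    obtain ⟨hq, hr, hr'⟩ := hx
    have hn := notr q r hq hr hr'
    have e1 : blocksAt j j' (splitBlock (b q) q r) = r := by
      ext W
      simp only [blocksAt, splitBlock, mem_filter, mem_union]
      have := hn W
      have := hr' W
      tauto
    have e2 : mergedBlock j' r = b q := by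
      ext x
      have := hr.cover x
      have h3 : j' ∉ b q := fun h => hT (hq.subset (hb q hq).1 h)
      simp only [mergedBlock, mem_erase, mem_biUnion, id, ← this, mem_insert]
      constructor
      · tauto
      · intro h
        exact ⟨fun h' => h3 (h' ▸ h), Or.inr h⟩
    have e3 : splitBlock (b q) q r \ r = q.erase (b q) := by
      ext W
      simp only [splitBlock, Finset.mem_sdiff, mem_union]
      have := hn W
      have := hr' W
      tauto
    simp only [mergeBlocks, e1, e2, e3, insert_erase (hb q hq).1]
  · intro P hP
    have hP' := mem_ncPartitions.1 hP
    have hm := hP'.merge hj hjT hT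
    have hjm : j ∈ mergedBlock j' (blocksAt j j' P) := by
      obtain ⟨W, hW, h⟩ := (hP'.cover j).1 (mem_insert_of_mem hjT)
      exact mem_mergedBlock_blocksAt.2 ⟨hj.lt.ne, W, hW, Or.inl h, h⟩
    have e : b (mergeBlocks j j' P) = mergedBlock j' (blocksAt j j' P) :=
      hm.eq_of_mem _ (hb _ hm).1 _ (mem_insert_self _ _) j (hb _ hm).2 hjm
    change splitBlock (b (mergeBlocks j j' P)) (mergeBlocks j j' P) (blocksAt j j' P) = P
    rw [e, splitBlock, mergeBlocks, erase_insert]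
    · exact sdiff_union_of_subset (filter_subset _ _)
    · intro h
      simp only [Finset.mem_sdiff] at h
      exact h.2 (mem_filter.2 ⟨h.1, Or.inl hjm⟩)
  · rintro ⟨q, r⟩ hx
    simp only [mem_sigma, mem_splitPartitions, mem_ncPartitions] at hx
    obtain ⟨hq, hr, hr'⟩ := hx
    rw [splitBlock, prod_union]
    rw [disjoint_left]
    intro V hV hVr
    have := notr q r hq hr hr' V hV
    have := hr' V hVr
    tauto

end

/-! ### Neighbours in a common block -/

/-- A non-crossing partition without one-element blocks has a block containing two neighbours. -/
theorem IsNCPartition.exists_adjacent {N : ℕ} {P : Finset (Finset (Fin N))} (hN : 0 < N)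
    (hP : IsNCPartition univ P) (h1 : ∀ V ∈ P, ∀ x, V ≠ {x}) :
    ∃ V ∈ P, ∃ s ∈ V, ∃ t ∈ V, (s : ℕ) + 1 = t := by
  have other : ∀ V ∈ P, ∀ x ∈ V, ∃ y ∈ V, y ≠ x := by
    intro V hV x hx
    by_contra! h
    exact h1 V hV x (Finset.eq_singleton_iff_unique_mem.2 ⟨hx, h⟩)
  have ex : ∃ d : ℕ, ∃ V ∈ P, ∃ x ∈ V, ∃ y ∈ V, x < y ∧ (y : ℕ) - x = d := by
    obtain ⟨V, hV, hx⟩ := (hP.cover ⟨0, hN⟩).1 (mem_univ _)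
    obtain ⟨y, hy, hne⟩ := other V hV _ hx
    refine ⟨_, V, hV, _, hx, y, hy, ?_, rfl⟩
    exact lt_of_le_of_ne (Nat.zero_le _) hne.symm
  classical
  obtain ⟨V, hV, x, hx, y, hy, hxy, hd⟩ := Nat.find_spec ex
  have hmin : ∀ W ∈ P, ∀ u ∈ W, ∀ v ∈ W, u < v → (y : ℕ) - x ≤ v - u := fun W hW u hu v hv huv =>
    hd ▸ Nat.find_min' ex ⟨W, hW, u, hu, v, hv, huv, rfl⟩
  by_cases hadj : (x : ℕ) + 1 = y
  · exact ⟨V, hV, x, hx, y, hy, hadj⟩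
  -- `x < y` are at minimal distance within a block. If `z = x + 1` differs from `y`, then a second
  -- element `w` of the block of `z` either lies between `z` and `y`, against minimality, or lies
  -- outside `[x, y]` and produces a crossing.
  exfalso
  have hxy' : (x : ℕ) < y := hxy
  obtain ⟨z, hz⟩ : ∃ z : Fin N, (z : ℕ) = x + 1 := ⟨⟨x + 1, by omega⟩, rfl⟩
  have hxz : x < z := Fin.lt_def.2 (by omega)
  have hzy : z < y := Fin.lt_def.2 (by omega)
  obtain ⟨W, hW, hzW⟩ := (hP.cover z).1 (mem_univ _)
  obtain ⟨w, hw, hwz⟩ := other W hW z hzW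
  have hVW : V ≠ W := by
    rintro rfl
    have := hmin V hV x hx z hzW hxz
    omega
  rcases lt_or_gt_of_ne hwz with h | h
  · rcases lt_trichotomy w x with h' | h' | h'
    · exact hP.not_cross hW hV hVW.symm h' hxz hzy hw hzW hx hy
    · subst h'
      exact hVW (hP.eq_of_mem V hV W hW w hx hw)
    · rw [Fin.lt_def] at h h'
      omega
  · rcases lt_trichotomy w y with h' | h' | h'
    · have := hmin W hW z hzW w hw h
      rw [Fin.lt_def] at h h'
      omega
    · subst h'
      exact hVW (hP.eq_of_mem V hV W hW w hy hw)
    · exact hP.not_cross hV hW hVW hxz hzy h' hx hy hzW hw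

/-! ### Transport along order embeddings; comparison with `NC` -/

section

variable {α β : Type*} [LinearOrder α] [LinearOrder β] {R : Type*} [CommRing R]

theorem IsNCPartition.map_iff (e : α ↪o β) {S : Finset α} {P : Finset (Finset α)} :
    IsNCPartition (S.map e.toEmbedding) (P.map (mapEmbedding e.toEmbedding).toEmbedding) ↔
      IsNCPartition S P := by
  have hm : ∀ (V : Finset α) (x : α), e x ∈ V.map e.toEmbedding ↔ x ∈ V := fun V x =>
    mem_map' e.toEmbedding
  have hV : ∀ V : Finset α, (mapEmbedding e.toEmbedding).toEmbedding V = V.map e.toEmbedding :=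
    fun V => rfl
  constructor
  · intro h
    constructor
    · intro V hVP
      exact (map_nonempty (f := e.toEmbedding)).1 (h.nonempty _ (mem_map_of_mem _ hVP))
    · intro x
      have := h.cover (e x)
      simpa only [hm, Finset.mem_map, exists_exists_and_eq_and, hV] using this
    · intro V hVP W hWP x hx hx'
      exact map_injective e.toEmbedding (h.eq_of_mem _ (mem_map_of_mem _ hVP) _
        (mem_map_of_mem _ hWP) (e x) ((hm _ _).2 hx) ((hm _ _).2 hx'))
    · intro a b c d h1 h2 h3 V hVP W hWP ha hc hb hd
      exact map_injective e.toEmbedding (h.noncrossing (e a) (e b) (e c) (e d) (e.lt_iff_lt.2 h1)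
        (e.lt_iff_lt.2 h2) (e.lt_iff_lt.2 h3) _ (mem_map_of_mem _ hVP) _ (mem_map_of_mem _ hWP)
        ((hm _ _).2 ha) ((hm _ _).2 hc) ((hm _ _).2 hb) ((hm _ _).2 hd))
  · intro h
    constructor
    · intro V' hV'
      obtain ⟨V, hVP, rfl⟩ := Finset.mem_map.1 hV'
      exact (h.nonempty V hVP).map
    · intro y
      simp only [Finset.mem_map, exists_exists_and_eq_and, hV]
      constructor
      · rintro ⟨x, hx, rfl⟩
        obtain ⟨V, hVP, hxV⟩ := (h.cover x).1 hx
        exact ⟨V, hVP, x, hxV, rfl⟩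
      · rintro ⟨V, hVP, x, hxV, rfl⟩
        exact ⟨x, h.subset hVP hxV, rfl⟩
    · intro V' hV' W' hW' y hy hy'
      obtain ⟨V, hVP, rfl⟩ := Finset.mem_map.1 hV'
      obtain ⟨W, hWP, rfl⟩ := Finset.mem_map.1 hW'
      obtain ⟨x, hx, rfl⟩ := Finset.mem_map.1 hy
      rw [h.eq_of_mem V hVP W hWP x hx ((hm W x).1 hy')]
    · intro a b c d h1 h2 h3 V' hV' W' hW' ha hc hb hd
      obtain ⟨V, hVP, rfl⟩ := Finset.mem_map.1 hV'
      obtain ⟨W, hWP, rfl⟩ := Finset.mem_map.1 hW'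
      obtain ⟨a, ha, rfl⟩ := Finset.mem_map.1 ha
      obtain ⟨b, hb, rfl⟩ := Finset.mem_map.1 hb
      obtain ⟨c, hc, rfl⟩ := Finset.mem_map.1 hc
      obtain ⟨d, hd, rfl⟩ := Finset.mem_map.1 hd
      rw [h.noncrossing a b c d (e.lt_iff_lt.1 h1) (e.lt_iff_lt.1 h2) (e.lt_iff_lt.1 h3)
        V hVP W hWP ((hm _ _).1 ha)
        ((hm _ _).1 hc) ((hm _ _).1 hb) ((hm _ _).1 hd)]

theorem ncSum_map (g : Finset β → R) (e : α ↪o β) (S : Finset α) :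
    ncSum g (S.map e.toEmbedding) = ncSum (fun V => g (V.map e.toEmbedding)) S := by
  symm
  refine sum_bij (fun P _ => P.map (mapEmbedding e.toEmbedding).toEmbedding) ?_ ?_ ?_ ?_
  · intro P hP
    exact mem_ncPartitions.2 ((IsNCPartition.map_iff e).2 (mem_ncPartitions.1 hP))
  · intro P _ Q _ h
    exact map_injective _ h
  · intro Q hQ
    have hQ' := mem_ncPartitions.1 hQ
    obtain ⟨P, rfl⟩ : ∃ P : Finset (Finset α),
        P.map (mapEmbedding e.toEmbedding).toEmbedding = Q := by
      have : (Q : Set (Finset β)) ⊆ Set.range (mapEmbedding e.toEmbedding).toEmbedding := by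
        intro V hV
        obtain ⟨W, -, rfl⟩ := subset_map_iff.1 (hQ'.subset hV)
        exact ⟨W, rfl⟩
      refine ⟨Q.preimage _ (mapEmbedding e.toEmbedding).injective.injOn, ?_⟩
      ext V
      rw [Finset.mem_map]
      constructor
      · rintro ⟨W, hW, rfl⟩
        exact Finset.mem_preimage.1 hW
      · intro hV
        obtain ⟨W, rfl⟩ := this hV
        exact ⟨W, Finset.mem_preimage.2 hV, rfl⟩
    exact ⟨P, mem_ncPartitions.2 ((IsNCPartition.map_iff e).1 hQ'), rfl⟩
  · intro P _
    rw [prod_map]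
    rfl

theorem sum_NC_eq {M : Type*} [AddCommMonoid M] {n : ℕ} (f : Finset (Finset (Fin n)) → M) :
    ∑ p ∈ NC n, f p.parts = ∑ P ∈ ncPartitions univ, f P := by
  refine sum_bij (fun p _ => p.parts) ?_ ?_ ?_ ?_
  · intro p hp
    rw [mem_ncPartitions]
    exact
      { nonempty := fun V hV => p.nonempty_of_mem_parts hV
        cover := fun x => ⟨fun hx => p.exists_mem hx, fun _ => mem_univ x⟩
        eq_of_mem := fun V hV W hW x hx hx' => p.eq_of_mem_parts hV hW hx hx'
        noncrossing := (mem_filter.1 hp).2 }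
  · intro p _ q _ h
    exact Finpartition.ext h
  · intro P hP
    have hP := mem_ncPartitions.1 hP
    refine ⟨⟨P, ?_, ?_, ?_⟩, mem_filter.2 ⟨mem_univ _, hP.noncrossing⟩, rfl⟩
    · rw [Finset.supIndep_iff_pairwiseDisjoint]
      intro V hV W hW hne
      exact Finset.disjoint_left.2 fun x hx hx' => hne (hP.eq_of_mem V hV W hW x hx hx')
    · ext x
      simpa using hP.cover x
    · intro h
      exact (hP.nonempty _ h).ne_empty rfl
  · intro p _
    rfl

end

/-! ### Subtuples and ordered products -/

section

variable {A : Type*}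

/-- The increasing enumeration of `V` is unique. Allowing any `m` with an embedding onto `V` makes
it possible to substitute `V.card` for `m`, which avoids casts between tuple types. -/
theorem apply_comp_orderEmb {R : Type*} (κ : (n : ℕ) → (Fin n → A) → R) {m N : ℕ} (a : Fin N → A)
    (e : Fin m ↪o Fin N) {V : Finset (Fin N)} (hV : univ.map e.toEmbedding = V) :
    κ m (a ∘ e) = κ V.card (restrictTuple a V) := by
  have hc : V.card = m := by rw [← hV, card_map, card_univ, Fintype.card_fin]
  subst hc
  have : e = V.orderEmbOfFin rfl := orderEmbOfFin_unique' rfl fun x => by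
    have h := mem_map_of_mem e.toEmbedding (mem_univ x)
    rw [hV] at h
    exact h
  rw [this]
  rfl

/-- The value of `κ` on the entries of `a` with index in `V`. -/
def blockValue {R : Type*} (κ : (n : ℕ) → (Fin n → A) → R) {N : ℕ} (a : Fin N → A)
    (V : Finset (Fin N)) : R :=
  κ V.card (restrictTuple a V)

theorem blockValue_univ {R : Type*} (κ : (n : ℕ) → (Fin n → A) → R) {N : ℕ} (a : Fin N → A) :
    blockValue κ a univ = κ N a :=
  (apply_comp_orderEmb κ a (OrderIso.refl (Fin N)).toOrderEmbedding (by ext; simp)).symm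

theorem blockValue_congr {R : Type*} (κ : (n : ℕ) → (Fin n → A) → R) {N : ℕ} {a b : Fin N → A}
    {V : Finset (Fin N)} (h : ∀ x ∈ V, a x = b x) : blockValue κ a V = blockValue κ b V := by
  unfold blockValue
  congr 1
  funext x
  exact h _ (orderEmbOfFin_mem V rfl x)

theorem blockValue_restrictTuple {R : Type*} (κ : (n : ℕ) → (Fin n → A) → R) {N : ℕ}
    (a : Fin N → A) (S : Finset (Fin N)) (W : Finset (Fin S.card)) :
    blockValue κ (restrictTuple a S) W =
      blockValue κ a (W.map (S.orderEmbOfFin rfl).toEmbedding) := by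
  refine apply_comp_orderEmb κ a ((W.orderEmbOfFin rfl).trans (S.orderEmbOfFin rfl)) ?_
  conv_rhs => rw [← map_orderEmbOfFin_univ W rfl]
  rw [Finset.map_map]
  rfl

theorem list_prod_map_filter {M ι : Type*} [Monoid M] (p : ι → Prop) [DecidablePred p]
    (f : ι → M) (L : List ι) :
    ((L.filter p).map f).prod = (L.map fun x => if p x then f x else 1).prod := by
  induction L with
  | nil => rfl
  | cons x L ih => by_cases h : p x <;> simp [h, ih]

/-- Padding by `1` lets the moments of all subtuples be indexed by the same `Fin N`, so that they
can be compared entry by entry. -/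
theorem prod_restrictTuple [Monoid A] {N : ℕ} (a : Fin N → A) (S : Finset (Fin N)) :
    (List.ofFn (restrictTuple a S)).prod = (List.ofFn fun m => if m ∈ S then a m else 1).prod := by
  have h : List.ofFn (S.orderEmbOfFin rfl) = (List.finRange N).filter (· ∈ S) := by
    have p1 : (List.ofFn (S.orderEmbOfFin rfl)).Pairwise (· < ·) := by
      rw [List.pairwise_ofFn]
      exact fun i j hij => (S.orderEmbOfFin rfl).strictMono hij
    have p2 : ((List.finRange N).filter (· ∈ S)).Pairwise (· < ·) :=
      (List.pairwise_lt_finRange N).filter _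
    refine List.Perm.eq_of_pairwise (fun a b _ _ h1 h2 => absurd h2 h1.asymm) p1 p2 ?_
    refine (List.perm_ext_iff_of_nodup (p1.imp fun h => h.ne) (p2.imp fun h => h.ne)).2 fun x => ?_
    have := Set.ext_iff.1 (range_orderEmbOfFin S rfl) x
    simpa only [List.mem_ofFn, List.mem_filter, List.mem_finRange, true_and, decide_eq_true_eq,
      Set.mem_range, mem_coe] using this
  have h2 : List.ofFn (restrictTuple a S) = (List.ofFn (S.orderEmbOfFin rfl)).map a := by
    rw [List.map_ofFn]
    rfl
  rw [h2, h, list_prod_map_filter, List.ofFn_eq_map]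

theorem list_prod_ofFn_merge [Monoid A] :
    ∀ {N : ℕ} (f g : Fin N → A) (j j' : Fin N), (j : ℕ) + 1 = j' → f j * f j' = g j * g j' →
      (∀ x, x ≠ j → x ≠ j' → f x = g x) → (List.ofFn f).prod = (List.ofFn g).prod
  | 0, _, _, j, _, _, _, _ => j.elim0
  | N + 1, f, g, j, j', hj, h, hx => by
    obtain rfl | ⟨i, rfl⟩ := j.eq_zero_or_eq_succ
    · obtain _ | N := N
      · have := j'.isLt
        simp only [Fin.val_zero] at hj
        omega
      · obtain rfl : j' = 1 := Fin.ext (by simpa using hj.symm)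
        simp only [List.ofFn_succ, List.prod_cons, ← mul_assoc]
        rw [show (Fin.succ 0 : Fin (N + 2)) = 1 from rfl, h]
        congr 3
        funext x
        exact hx _ (Fin.succ_ne_zero _) fun h => by
          have := congrArg Fin.val h
          simp at this
    · obtain rfl | ⟨i', rfl⟩ := j'.eq_zero_or_eq_succ
      · simp at hj
      · rw [List.ofFn_succ, List.ofFn_succ, List.prod_cons, List.prod_cons,
          hx 0 (Fin.succ_ne_zero _).symm (Fin.succ_ne_zero _).symm]
        congr 1
        refine list_prod_ofFn_merge _ _ i i' (by simpa using hj) h fun x h1 h2 => ?_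
        exact hx _ (fun h => h1 (Fin.succ_injective _ h)) fun h => h2 (Fin.succ_injective _ h)

end

/-! ### Free cumulants with values in a commutative ring -/

/-- `κ` are the free cumulants of `τ`: the moment-cumulant formula with values in `R`. -/
structure IsFreeCumulant {A R : Type*} [Monoid A] [CommRing R] (τ : A → R)
    (κ : (n : ℕ) → (Fin n → A) → R) : Prop where
  one : τ 1 = 1
  moment : ∀ n, 0 < n → ∀ a : Fin n → A,
    ncSum (blockValue κ a) univ = τ (List.ofFn a).prod

namespace IsFreeCumulant

variable {A R : Type*} [Monoid A] [CommRing R] {τ : A → R} {κ : (n : ℕ) → (Fin n → A) → R}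

theorem ncSum_blockValue (h : IsFreeCumulant τ κ) {N : ℕ} (a : Fin N → A) (S : Finset (Fin N)) :
    ncSum (blockValue κ a) S = τ (List.ofFn fun m => if m ∈ S then a m else 1).prod := by
  rw [← prod_restrictTuple]
  obtain rfl | hS := S.eq_empty_or_nonempty
  · rw [ncSum_empty]
    exact h.one.symm
  · rw [← h.moment _ hS.card_pos]
    conv_lhs => rw [← map_orderEmbOfFin_univ S rfl]
    rw [ncSum_map]
    exact ncSum_congr fun V _ _ => (blockValue_restrictTuple κ a S V).symm

theorem blockValue_singleton (h : IsFreeCumulant τ κ) {N : ℕ} (a : Fin N → A) (m : Fin N) :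
    blockValue κ a {m} = τ (a m) := by
  have h1 : ∀ b : Fin 1 → A, κ 1 b = τ (b 0) := fun b => by
    have := h.moment 1 one_pos b
    rw [ncSum_eq_add _ univ_nonempty, blockValue_univ, sum_eq_zero, add_zero] at this
    · simpa using this
    · intro P hP
      rw [mem_erase, mem_ncPartitions] at hP
      obtain ⟨V, hV, h0⟩ := (hP.2.cover 0).1 (mem_univ _)
      refine absurd (Finset.eq_univ_iff_forall.2 fun x => ?_) (hP.2.ssubset hP.1 hV).ne
      rwa [Subsingleton.elim x 0]
  have : blockValue κ a {m} = κ 1 fun _ => a m :=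
    (apply_comp_orderEmb κ a ⟨⟨fun _ : Fin 1 => m, fun x y _ => Subsingleton.elim x y⟩,
      by intro x y; simp [Subsingleton.elim x y]⟩ (by
        ext x
        simp only [Finset.mem_map, mem_univ, true_and, mem_singleton]
        exact ⟨fun ⟨_, h⟩ => h.symm, fun h => ⟨0, h.symm⟩⟩)).symm
  rw [this, h1]

end IsFreeCumulant

/-- The expansion of `τ ((a₁ - τ a₁) ⋯ (a_N - τ a_N))`. -/
def centeredExpansion {A R : Type*} [Monoid A] [CommRing R] (τ : A → R) {N : ℕ}
    (a : Fin N → A) : R :=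
  ∑ T ∈ (univ : Finset (Fin N)).powerset,
    (∏ m ∈ T, -τ (a m)) * τ (List.ofFn fun m => if m ∈ T then 1 else a m).prod

/-- Vanishing of mixed cumulants. -/
def MixedVanish {A R : Type*} [CommRing R] (κ : (n : ℕ) → (Fin n → A) → R) {n : ℕ}
    (M : Fin n → Set A) (N : ℕ) : Prop :=
  ∀ (ι : Fin N → Fin n) (a : Fin N → A), (∀ s, a s ∈ M (ι s)) →
    (∃ s t, s < t ∧ ι s ≠ ι t) → κ N a = 0

theorem MixedVanish.blockValue_eq_zero {A R : Type*} [CommRing R]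
    {κ : (n : ℕ) → (Fin n → A) → R} {n : ℕ} {M : Fin n → Set A} {N : ℕ} {a : Fin N → A}
    {ι : Fin N → Fin n} {V : Finset (Fin N)} (hκ : MixedVanish κ M V.card)
    (ha : ∀ s ∈ V, a s ∈ M (ι s)) {s t : Fin N} (hs : s ∈ V) (ht : t ∈ V) (hst : ι s ≠ ι t) :
    blockValue κ a V = 0 := by
  have ex : ∀ x ∈ V, ∃ y, V.orderEmbOfFin rfl y = x := fun x hx => by
    have : x ∈ Set.range (V.orderEmbOfFin rfl) := by rwa [range_orderEmbOfFin]
    exact this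
  obtain ⟨s, rfl⟩ := ex s hs
  obtain ⟨t, rfl⟩ := ex t ht
  refine hκ (ι ∘ V.orderEmbOfFin rfl) _ (fun x => ha _ (orderEmbOfFin_mem V rfl x)) ?_
  rcases lt_trichotomy s t with h | h | h
  · exact ⟨s, t, h, hst⟩
  · exact absurd (by rw [h]) hst
  · exact ⟨t, s, h, hst.symm⟩

open scoped Classical in
theorem prod_blockValue_eq_zero_of_alternating {A R : Type*} [CommRing R]
    {κ : (n : ℕ) → (Fin n → A) → R} {n N : ℕ} (hN : 0 < N) {M : Fin n → Set A}
    {a : Fin N → A} {ι : Fin N → Fin n} (ha : ∀ s, a s ∈ M (ι s))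
    (hι : ∀ s t : Fin N, (s : ℕ) + 1 = t → ι s ≠ ι t) {P : Finset (Finset (Fin N))}
    (hP : IsNCPartition univ P) (hκ : ∀ V ∈ P, MixedVanish κ M V.card) :
    ∏ V ∈ P, (if ∃ m, V = {m} then 0 else blockValue κ a V) = 0 := by
  by_cases h1 : ∃ V ∈ P, ∃ x, V = {x}
  · obtain ⟨V, hV, hx⟩ := h1
    exact prod_eq_zero hV (if_pos hx)
  · push Not at h1
    obtain ⟨V, hV, s, hs, t, ht, hst⟩ := hP.exists_adjacent hN h1
    refine prod_eq_zero hV ?_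
    rw [(hκ V hV).blockValue_eq_zero (fun x _ => ha x) hs ht (hι s t hst), ite_self]

namespace IsFreeCumulant

variable {A R : Type*} [Monoid A] [CommRing R] {τ : A → R} {κ : (n : ℕ) → (Fin n → A) → R}

-- One-element cumulants are the values `τ (a m)`, so expanding the centered product is the same
-- inclusion-exclusion that removes one-element blocks.
open scoped Classical in
theorem centeredExpansion_eq (h : IsFreeCumulant τ κ) {N : ℕ} (a : Fin N → A) :
    centeredExpansion τ a =
      ncSum (fun V => if ∃ m, V = {m} then 0 else blockValue κ a V) univ := by
  have := ncSum_remove_singletons (blockValue κ a) univ univ Subset.rfl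
  simp only [mem_univ, true_and] at this
  rw [this, centeredExpansion]
  refine sum_congr rfl fun T _ => ?_
  congr 1
  · exact prod_congr rfl fun m _ => by rw [h.blockValue_singleton]
  · rw [h.ncSum_blockValue]
    congr 3
    funext m
    simp only [Finset.mem_sdiff, mem_univ, true_and, ite_not]

/-- The cumulant with two neighbouring entries multiplied. -/
theorem blockValue_mul (h : IsFreeCumulant τ κ) {N : ℕ} (a : Fin N → A) {j j' : Fin N}
    (hj : (j : ℕ) + 1 = j') :
    blockValue κ (Function.update a j (a j * a j')) (univ.erase j') =
      splitSum (blockValue κ a) j j' (univ.erase j') := by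
  have hlt : j < j' := Fin.lt_def.2 (by omega)
  have hcov : j ⋖ j' := ⟨hlt, fun x h1 h2 => by rw [Fin.lt_def] at h1 h2; omega⟩
  have hjT : j ∈ univ.erase j' := mem_erase.2 ⟨hlt.ne, mem_univ _⟩
  -- Both sides are determined by their sums over the partitions of each `S`. If `j ∈ S`, both sums
  -- are the moment over `S ∪ {j'}`, since multiplying two neighbours does not change the product;
  -- if `j ∉ S`, the two functions agree on the subsets of `S`.
  have key := eq_of_ncSum_eq (g := blockValue κ (Function.update a j (a j * a j')))
    (h := fun V => if j ∈ V then splitSum (blockValue κ a) j j' V else blockValue κ a V)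
    (univ.erase j') ⟨j, hjT⟩ ?_
  · simpa only [if_pos hjT] using key
  intro S hS _
  have hj'S : j' ∉ S := fun h => notMem_erase _ _ (hS h)
  by_cases hjS : j ∈ S
  · rw [ncSum_splitSum _ hcov hjS hj'S, h.ncSum_blockValue, h.ncSum_blockValue]
    congr 1
    refine list_prod_ofFn_merge _ _ j j' hj ?_ fun x h1 h2 => ?_
    · simp [hjS, hj'S]
    · simp [h1, h2]
  · have e1 : ncSum (fun V => if j ∈ V then splitSum (blockValue κ a) j j' V else
        blockValue κ a V) S = ncSum (blockValue κ a) S :=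
      ncSum_congr fun V hV _ => if_neg fun h => hjS (hV h)
    rw [e1]
    refine ncSum_congr fun V hV _ => blockValue_congr κ fun x hx => ?_
    rw [Function.update_of_ne]
    rintro rfl
    exact hjS (hV hx)

/-- Multiplying the entries at `j` and `j'` gives a mixed cumulant of length `N - 1`, which is zero.
Its expansion consists of `κ N a` and of products over partitions whose blocks all meet `{j, j'}`.
In such a product, the block of an index `x` from another algebra is mixed and shorter than `N`, so
the product vanishes. -/
theorem eq_zero_of_not_alternating (h : IsFreeCumulant τ κ) {n N : ℕ} {M : Fin n → Submonoid A}
    (hκ : ∀ m < N, MixedVanish κ (fun u => (M u : Set A)) m) {a : Fin N → A} {ι : Fin N → Fin n}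
    (ha : ∀ s, a s ∈ M (ι s)) (hmix : ∃ s t, s < t ∧ ι s ≠ ι t) {j j' : Fin N}
    (hj : (j : ℕ) + 1 = j') (hι : ι j = ι j') : κ N a = 0 := by
  classical
  have hne : j ≠ j' := fun h => by rw [h] at hj; omega
  have hjT : j ∈ univ.erase j' := mem_erase.2 ⟨hne, mem_univ _⟩
  have hcard : (univ.erase j').card < N := by
    rw [card_erase_of_mem (mem_univ _), card_univ, Fintype.card_fin]
    have := j.isLt
    omega
  obtain ⟨x, hx⟩ : ∃ x, ι x ≠ ι j := by
    by_contra! H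
    obtain ⟨s, t, -, hst⟩ := hmix
    exact hst ((H s).trans (H t).symm)
  have hmul := h.blockValue_mul a hj
  rw [(hκ _ hcard).blockValue_eq_zero (ι := ι) (s := x) (t := j) ?_ ?_ hjT hx] at hmul
  rotate_left
  · intro s _
    by_cases hs : s = j
    · subst hs
      rw [Function.update_self]
      exact (M _).mul_mem (ha s) (hι ▸ ha j')
    · rw [Function.update_of_ne hs]
      exact ha s
  · refine mem_erase.2 ⟨?_, mem_univ _⟩
    rintro rfl
    exact hx hι.symm
  have hU : insert j' (univ.erase j') = univ := insert_erase (mem_univ j')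
  rw [splitSum, ← add_sum_erase (a := {univ})] at hmul
  rotate_left
  · refine mem_splitPartitions.2 ⟨by rw [hU]; exact .singleton ⟨j, mem_univ _⟩, ?_⟩
    simp
  rw [prod_singleton, blockValue_univ, sum_eq_zero, add_zero] at hmul
  · exact hmul.symm
  intro r hr
  rw [mem_erase, mem_splitPartitions, hU] at hr
  obtain ⟨hr1, hr2, hr3⟩ := hr
  obtain ⟨W, hW, hxW⟩ := (hr2.cover x).1 (mem_univ x)
  have hWc : W.card < N := by
    have := card_lt_card (hr2.ssubset hr1 hW)
    rwa [card_univ, Fintype.card_fin] at this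
  refine prod_eq_zero hW ?_
  rcases hr3 W hW with h' | h'
  · exact (hκ _ hWc).blockValue_eq_zero (fun s _ => ha s) hxW h' hx
  · exact (hκ _ hWc).blockValue_eq_zero (fun s _ => ha s) hxW h' (hι ▸ hx)

/-- Vanishing of mixed cumulants is equivalent to the vanishing of alternating centered moments. -/
theorem mixedVanish_iff (h : IsFreeCumulant τ κ) {n : ℕ} (M : Fin n → Submonoid A) :
    (∀ N, MixedVanish κ (fun u => (M u : Set A)) N) ↔
      ∀ N, 0 < N → ∀ (ι : Fin N → Fin n) (a : Fin N → A), (∀ s, a s ∈ M (ι s)) →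
        (∀ s t : Fin N, (s : ℕ) + 1 = t → ι s ≠ ι t) → centeredExpansion τ a = 0 := by
  classical
  constructor
  · intro hκ N hN ι a ha hι
    rw [h.centeredExpansion_eq]
    exact sum_eq_zero fun P hP => prod_blockValue_eq_zero_of_alternating hN (M := fun u => (M u : Set A)) ha hι
      (mem_ncPartitions.1 hP) fun V _ => hκ V.card
  · intro hD N
    induction N using Nat.strong_induction_on with
    | _ N ih =>
      intro ι a ha hmix
      by_cases hι : ∀ s t : Fin N, (s : ℕ) + 1 = t → ι s ≠ ι t
      · obtain ⟨s, t, hst, -⟩ := hmix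
        have hN : 0 < N := (Nat.zero_le _).trans_lt s.isLt
        have h0 := hD N hN ι a ha hι
        rw [h.centeredExpansion_eq, ncSum_eq_add _ ⟨s, mem_univ s⟩, if_neg, blockValue_univ,
          sum_eq_zero, add_zero] at h0
        · exact h0
        · intro P hP
          rw [mem_erase, mem_ncPartitions] at hP
          refine prod_blockValue_eq_zero_of_alternating hN (M := fun u => (M u : Set A)) ha hι hP.2
            fun V hV => ih _ ?_
          have := card_lt_card (hP.2.ssubset hP.1 hV)
          rwa [card_univ, Fintype.card_fin] at this
        -- A mixed tuple has at least two entries, so the full block is not one of the deleted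
        -- singletons.
        · rintro ⟨m, hm⟩
          have h1 : s ∈ ({m} : Finset (Fin N)) := hm ▸ mem_univ s
          have h2 : t ∈ ({m} : Finset (Fin N)) := hm ▸ mem_univ t
          rw [mem_singleton] at h1 h2
          exact hst.ne (h1.trans h2.symm)
      · push Not at hι
        obtain ⟨j, j', hj, hjj⟩ := hι
        exact h.eq_zero_of_not_alternating ih ha hmix hj hjj

end IsFreeCumulant

/-! ### Little-o conditions on polynomials -/

open Polynomial in
theorem isLittleO_eval_iff (Q : ℂ[X]) (k : ℕ) {K : Set ℝ} (hK : AccPt (0 : ℝ) (𝓟 K)) :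
    (fun t : ℝ => Q.eval (t : ℂ)) =o[𝓝[K \ {0}] (0 : ℝ)] (fun t : ℝ => t ^ k) ↔
      ∀ i < k + 1, Q.coeff i = 0 := by
  have hne : (𝓝[K \ {0}] (0 : ℝ)).NeBot := by
    rw [AccPt, nhdsWithin, inf_assoc, inf_principal, Set.inter_comm] at hK
    rwa [nhdsWithin, Set.sdiff_eq]
  have htend : ∀ S : ℂ[X], Tendsto (fun t : ℝ => S.eval (t : ℂ)) (𝓝[K \ {0}] (0 : ℝ))
      (𝓝 (S.eval 0)) := fun S => by
    have : Continuous fun t : ℝ => S.eval (t : ℂ) := S.continuous.comp Complex.continuous_ofReal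
    simpa using (this.tendsto 0).mono_left nhdsWithin_le_nhds
  constructor
  · intro h i
    induction i using Nat.strong_induction_on with
    | _ i ih =>
      intro hi
      -- With `Q = Xⁱ S`, the coefficient sought is `S(0)`. Dividing by `tⁱ` gives `S(t) =
      -- o(t^(k-i))`, hence `S(t) → 0`; the limit is unique because `0` is an accumulation point of
      -- `K`.
      obtain ⟨S, rfl⟩ := X_pow_dvd_iff.2 fun d hd => ih d hd (hd.trans hi)
      rw [coeff_X_pow_mul', if_pos le_rfl, Nat.sub_self, coeff_zero_eq_eval_zero]
      have h1 : (fun t : ℝ => ((t : ℂ) ^ i)⁻¹) =O[𝓝[K \ {0}] (0 : ℝ)] (fun t => (t ^ i)⁻¹) :=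
        isBigO_of_le _ fun t => by simp
      have h2 : (fun t : ℝ => S.eval (t : ℂ)) =o[𝓝[K \ {0}] (0 : ℝ)]
          (fun t : ℝ => t ^ (k - i)) := by
        refine (h.mul_isBigO h1).congr' ?_ ?_
        · filter_upwards [self_mem_nhdsWithin] with t ht
          have ht0 : (t : ℂ) ≠ 0 := Complex.ofReal_ne_zero.2 ht.2
          simp only [eval_mul, eval_pow, eval_X]
          field_simp
        · filter_upwards [self_mem_nhdsWithin] with t ht
          exact (pow_sub₀ t ht.2 (Nat.lt_succ_iff.1 hi)).symm
      have h3 : (fun t : ℝ => t ^ (k - i)) =O[𝓝[K \ {0}] (0 : ℝ)] (fun _ => (1 : ℝ)) :=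
        (((continuous_pow (k - i)).tendsto (0 : ℝ)).mono_left nhdsWithin_le_nhds).isBigO_one ℝ
      exact tendsto_nhds_unique (htend S) ((isLittleO_one_iff ℝ).1 (h2.trans_isBigO h3))
  · intro h
    obtain ⟨S, rfl⟩ := X_pow_dvd_iff.2 h
    have h1 : (fun t : ℝ => (X * S).eval (t : ℂ)) =o[𝓝[K \ {0}] (0 : ℝ)] (fun _ => (1 : ℝ)) :=
      (isLittleO_one_iff ℝ).2 (by
      have := htend (X * S)
      rwa [eval_mul, eval_X, zero_mul] at this)
    have h2 : (fun t : ℝ => (t : ℂ) ^ k) =O[𝓝[K \ {0}] (0 : ℝ)] (fun t : ℝ => t ^ k) :=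
      isBigO_of_le _ fun t => by simp
    refine (h2.mul_isLittleO h1).congr (fun t => ?_) fun t => mul_one _
    simp only [eval_mul, eval_pow, eval_X]
    ring

/-! ### Generating polynomials modulo `X ^ (k + 1)` -/

section

open Polynomial

/-- The truncated exponential generating polynomial of `c`. -/
def expPoly {k : ℕ} (c : Fin (k + 1) → ℂ) : ℂ[X] :=
  ∑ i : Fin (k + 1), monomial (i : ℕ) (c i / ((i : ℕ)! : ℂ))

theorem coeff_expPoly {k : ℕ} (c : Fin (k + 1) → ℂ) (i : Fin (k + 1)) :
    (expPoly c).coeff i = c i / ((i : ℕ)! : ℂ) := by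
  rw [expPoly, finsetSum_coeff, Finset.sum_eq_single i]
  · rw [coeff_monomial, if_pos rfl]
  · intro j _ hj
    rw [coeff_monomial, if_neg fun h => hj (Fin.ext h)]
  · simp

theorem coeff_prod_expPoly {k : ℕ} {ι : Type*} [Fintype ι] [DecidableEq ι]
    (c : ι → Fin (k + 1) → ℂ) (i : ℕ) :
    (∏ x, expPoly (c x)).coeff i =
      ∑ lam ∈ weakCompositions k ι i, ∏ x, c x (lam x) / ((lam x : ℕ)! : ℂ) := by
  have hprod : ∀ lam : ι → Fin (k + 1),
      ∏ x, monomial (lam x : ℕ) (c x (lam x) / ((lam x : ℕ)! : ℂ)) =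
        monomial (∑ x, (lam x : ℕ)) (∏ x, c x (lam x) / ((lam x : ℕ)! : ℂ)) := fun lam => by
    simp only [← C_mul_X_pow_eq_monomial, prod_mul_distrib, map_prod, prod_pow_eq_pow_sum]
  simp only [expPoly]
  rw [prod_univ_sum, Fintype.piFinset_univ, finsetSum_coeff, weakCompositions, sum_filter]
  exact sum_congr rfl fun lam _ => by rw [hprod, coeff_monomial]

/-- The ideal of polynomials of order at least `k + 1`. -/
abbrev truncIdeal (k : ℕ) : Ideal ℂ[X] :=
  Ideal.span {X ^ (k + 1)}

theorem mk_truncIdeal_eq_zero_iff {k : ℕ} (Q : ℂ[X]) :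
    Ideal.Quotient.mk (truncIdeal k) Q = 0 ↔ ∀ i < k + 1, Q.coeff i = 0 := by
  rw [Ideal.Quotient.eq_zero_iff_mem, Ideal.mem_span_singleton, X_pow_dvd_iff]

theorem mk_truncIdeal_eq_iff {k : ℕ} (Q Q' : ℂ[X]) :
    Ideal.Quotient.mk (truncIdeal k) Q = Ideal.Quotient.mk (truncIdeal k) Q' ↔
      ∀ i < k + 1, Q.coeff i = Q'.coeff i := by
  rw [← sub_eq_zero, ← map_sub, mk_truncIdeal_eq_zero_iff]
  simp only [coeff_sub, sub_eq_zero]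

theorem mk_expPoly_eq_zero_iff {k : ℕ} (c : Fin (k + 1) → ℂ) :
    Ideal.Quotient.mk (truncIdeal k) (expPoly c) = 0 ↔ ∀ i, c i = 0 := by
  rw [mk_truncIdeal_eq_zero_iff]
  constructor
  · intro h i
    have := h i i.isLt
    rw [coeff_expPoly] at this
    exact (div_eq_zero_iff.1 this).resolve_right (Nat.cast_ne_zero.2 (Nat.factorial_ne_zero _))
  · intro h i hi
    rw [coeff_expPoly c ⟨i, hi⟩, h, zero_div]

end

/-- `centeredExpansion` never forms `a - τ a` inside `A`, so it makes sense for `τ` with values in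
any commutative ring and commutes with ring maps. Evaluation at `t` and reduction modulo `X ^ (k +
1)` are the two cases needed. -/
theorem centeredExpansion_map {A R S : Type*} [Monoid A] [CommRing R] [CommRing S] (f : R →+* S)
    (τ : A → R) {N : ℕ} (a : Fin N → A) :
    f (centeredExpansion τ a) = centeredExpansion (fun x => f (τ x)) a := by
  simp only [centeredExpansion, map_sum, map_mul, map_prod, map_neg]

theorem apply_prod_sub_algebraMap {A : Type*} [Ring A] [Algebra ℂ A] (f : A →ₗ[ℂ] ℂ) {N : ℕ}
    (a : Fin N → A) :
    f (List.ofFn fun m => a m - algebraMap ℂ A (f (a m))).prod = centeredExpansion f a := by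
  classical
  have h1 : (fun m => a m - algebraMap ℂ A (f (a m))) =
      (fun m => (-f (a m)) • (1 : A)) + a := by
    funext m
    rw [Pi.add_apply, Algebra.algebraMap_eq_smul_one, neg_smul, neg_add_eq_sub]
  have h2 : ∀ x : Fin N → A, (List.ofFn x).prod = MultilinearMap.mkPiAlgebraFin ℂ N A x :=
    fun x => (MultilinearMap.mkPiAlgebraFin_apply x).symm
  rw [h1, h2, MultilinearMap.map_add_univ, map_sum, centeredExpansion, powerset_univ]
  refine sum_congr rfl fun T _ => ?_
  have h3 : T.piecewise (fun m => (-f (a m)) • (1 : A)) a =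
      T.piecewise (fun m => (-f (a m)) • (fun m => if m ∈ T then 1 else a m) m)
        (fun m => if m ∈ T then 1 else a m) := by
    funext m
    by_cases hm : m ∈ T <;> simp [hm]
  rw [h3, MultilinearMap.map_piecewise_smul, map_smul, smul_eq_mul, ← h2]

/-! ### Infinitesimal spaces as spaces over truncated polynomials -/

namespace InfNCProbSpace

open Polynomial

variable {k : ℕ} {A : Type*} [Ring A] [Algebra ℂ A] (P : InfNCProbSpace k A)

/-- Dividing the infinitesimal formula by `i!` turns its weights into `∏ 1/λ_V!`, and its left side
into the coefficient of `Xⁱ` in a sum of products of generating polynomials. Degrees above `k`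
disappear in the quotient. -/
theorem isFreeCumulant :
    IsFreeCumulant (fun a => Ideal.Quotient.mk (truncIdeal k) (expPoly fun i => P.phi i a))
      (fun n a => Ideal.Quotient.mk (truncIdeal k) (expPoly fun i => P.cumulant n i a)) where
  one := by
    rw [← map_one (Ideal.Quotient.mk (truncIdeal k)), mk_truncIdeal_eq_iff]
    intro i hi
    rw [coeff_expPoly _ ⟨i, hi⟩, coeff_one]
    by_cases h : i = 0
    · subst h
      have : P.phi ⟨0, hi⟩ 1 = 1 := P.phi_zero_one
      rw [this]
      simp
    · rw [P.phi_one _ fun h' => h (congrArg Fin.val h'), zero_div, if_neg h]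
  moment n hn a := by
    rw [ncSum, ← sum_NC_eq (fun Q => ∏ V ∈ Q, blockValue _ a V)]
    simp only [blockValue]
    simp only [← map_prod, ← map_sum]
    rw [mk_truncIdeal_eq_iff]
    intro i hi
    rw [coeff_expPoly _ ⟨i, hi⟩, ← P.moment_cumulant hn, cumulantSum, finsetSum_coeff, sum_div]
    refine sum_congr rfl fun p _ => ?_
    rw [← Finset.prod_coe_sort p.parts, coeff_prod_expPoly, sum_div]
    refine sum_congr rfl fun lam _ => ?_
    rw [prod_div_distrib]
    have : ((i ! : ℕ) : ℂ) ≠ 0 := Nat.cast_ne_zero.2 (Nat.factorial_ne_zero _)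
    field_simp

/-- The polynomial in `t` giving the centered moments. -/
def centeredPoly {l : ℕ} (a : Fin l → A) : ℂ[X] :=
  centeredExpansion (fun x => expPoly fun i => P.phi i x) a

theorem eval_centeredPoly {l : ℕ} (a : Fin l → A) (t : ℝ) :
    (P.centeredPoly a).eval (t : ℂ) = P.centeredMoment a t := by
  rw [centeredMoment, apply_prod_sub_algebraMap, centeredPoly, ← coe_evalRingHom,
    centeredExpansion_map]
  congr 1
  funext x
  simp only [coe_evalRingHom, expPoly, eval_finsetSum, eval_monomial, phit, LinearMap.sum_apply,
    LinearMap.smul_apply, smul_eq_mul]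
  exact sum_congr rfl fun i _ => by ring

/-- Sorted by powers of `t`, the constant term is centered by `φ⁽⁰⁾` and every later term carries a
minus sign. This is where the sign `(-1)^#{m | λ_m > 0}` comes from. -/
theorem sub_phit_eq (a : A) (t : ℝ) :
    a - algebraMap ℂ A (P.phit t a) = ∑ r : Fin (k + 1),
      ((if 0 < r then -1 else 1) * ((t : ℂ) ^ (r : ℕ) / ((r : ℕ)! : ℂ))) • P.phihat r a := by
  have h : ∀ r : Fin k, ((if 0 < r.succ then -1 else 1) *
      ((t : ℂ) ^ (r.succ : ℕ) / ((r.succ : ℕ)! : ℂ))) • P.phihat r.succ a =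
        -algebraMap ℂ A ((((t : ℂ) ^ (r.succ : ℕ) / ((r.succ : ℕ)! : ℂ)) • P.phi r.succ) a) :=
    fun r => by
      rw [if_pos r.succ_pos, phihat, if_neg r.succ_ne_zero, LinearMap.smul_apply, smul_eq_mul,
        map_mul, neg_one_mul, neg_smul, Algebra.smul_def]
  rw [Fin.sum_univ_succ, sum_congr rfl fun r _ => h r, sum_neg_distrib, phit, LinearMap.sum_apply,
    map_sum, Fin.sum_univ_succ]
  simp [phihat, sub_eq_add_neg]
  abel

theorem coeff_centeredPoly {l : ℕ} (a : Fin l → A) (i : Fin (k + 1)) :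
    (P.centeredPoly a).coeff i = P.momentExpr a i / ((i : ℕ)! : ℂ) := by
  set Q : ℂ[X] := ∑ j : Fin (k + 1), ∑ lam : Fin l → Fin (k + 1),
    monomial ((j : ℕ) + ∑ m, (lam m : ℕ)) (((-1 : ℂ) ^ (univ.filter fun m => 0 < lam m).card /
      (((j : ℕ)! : ℂ) * ∏ m, ((lam m : ℕ)! : ℂ))) *
        P.phi j (List.ofFn fun m => P.phihat (lam m) (a m)).prod) with hQ
  have heval : ∀ t : ℝ, (P.centeredPoly a).eval (t : ℂ) = Q.eval (t : ℂ) := by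
    intro t
    rw [eval_centeredPoly, centeredMoment, ← MultilinearMap.mkPiAlgebraFin_apply (R := ℂ)]
    simp only [P.sub_phit_eq]
    rw [MultilinearMap.map_sum]
    simp only [MultilinearMap.map_smul_univ, MultilinearMap.mkPiAlgebraFin_apply]
    rw [phit, LinearMap.sum_apply, hQ, eval_finsetSum]
    refine sum_congr rfl fun j _ => ?_
    rw [map_sum, eval_finsetSum]
    refine sum_congr rfl fun lam _ => ?_
    rw [map_smul, LinearMap.smul_apply, smul_eq_mul, smul_eq_mul, eval_monomial,
      prod_mul_distrib, prod_div_distrib, prod_pow_eq_pow_sum, pow_add, prod_ite, prod_const,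
      prod_const_one, mul_one]
    ring
  -- Agreement at the infinitely many real points forces equality of polynomials.
  have hPQ : P.centeredPoly a = Q := by
    refine eq_of_infinite_eval_eq _ _ (Set.Infinite.mono ?_
      (Set.infinite_range_of_injective Complex.ofReal_injective))
    rintro _ ⟨t, rfl⟩
    exact heval t
  have hi0 : ((i : ℕ)! : ℂ) ≠ 0 := Nat.cast_ne_zero.2 (Nat.factorial_ne_zero _)
  rw [hPQ, hQ, momentExpr, finsetSum_coeff, sum_div, ← filter_ge_eq_Iic, sum_filter]
  refine sum_congr rfl fun j _ => ?_
  rw [finsetSum_coeff]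
  -- For `j ≤ i` the natural-number difference `i - j` is not truncated, so the monomials of degree
  -- `i` are those with `∑ λ_m = i - j`. For `j > i` there are none.
  split_ifs with hj
  · rw [weakCompositions, sum_filter, sum_div]
    refine sum_congr rfl fun lam _ => ?_
    rw [coeff_monomial]
    have hj' : (j : ℕ) ≤ i := hj
    split_ifs with h1 h2 h2
    · field_simp
    · omega
    · omega
    · rw [zero_div]
  · refine sum_eq_zero fun lam _ => ?_
    rw [coeff_monomial, if_neg]
    intro h
    exact hj (Fin.le_def.2 (by omega))

theorem isLittleO_centeredMoment_iff {K : Set ℝ} (hK : AccPt (0 : ℝ) (𝓟 K)) {l : ℕ}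
    (a : Fin l → A) :
    P.centeredMoment a =o[𝓝[K \ {0}] (0 : ℝ)] (fun t : ℝ => t ^ k) ↔
      ∀ i < k + 1, (P.centeredPoly a).coeff i = 0 := by
  rw [← isLittleO_eval_iff _ _ hK]
  simp only [eval_centeredPoly]

theorem momentExpr_eq_zero_iff {l : ℕ} (a : Fin l → A) :
    (∀ i, P.momentExpr a i = 0) ↔ ∀ i < k + 1, (P.centeredPoly a).coeff i = 0 := by
  have hi0 : ∀ i : ℕ, ((i ! : ℕ) : ℂ) ≠ 0 := fun i => Nat.cast_ne_zero.2 (Nat.factorial_ne_zero _)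
  constructor
  · intro h i hi
    rw [P.coeff_centeredPoly a ⟨i, hi⟩, h, zero_div]
  · intro h i
    have := h i i.isLt
    rw [coeff_centeredPoly] at this
    exact (div_eq_zero_iff.1 this).resolve_right (hi0 i)

/-- This is `mixedVanish_iff` over `ℂ[X]/(X^(k+1))`, with the vanishing of classes read off
coefficientwise. -/
theorem isInfFree_iff {n : ℕ} (B : Fin n → Subalgebra ℂ A) :
    P.IsInfFree (fun u => (B u : Set A)) ↔
      ∀ (l : ℕ), 0 < l → ∀ (ι : Fin l → Fin n) (a : Fin l → A),
        (∀ s, a s ∈ B (ι s)) → (∀ s t : Fin l, (s : ℕ) + 1 = (t : ℕ) → ι s ≠ ι t) →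
          ∀ i < k + 1, (P.centeredPoly a).coeff i = 0 := by
  have h := P.isFreeCumulant.mixedVanish_iff fun u => (B u).toSubmonoid
  simp only [← centeredExpansion_map, MixedVanish, mk_expPoly_eq_zero_iff] at h
  simp only [mk_truncIdeal_eq_zero_iff] at h
  exact h

end InfNCProbSpace

theorem mainTheorem3 {k : ℕ} {A : Type*} [Ring A] [Algebra ℂ A] (P : InfNCProbSpace k A)
    {n : ℕ} (B : Fin n → Subalgebra ℂ A) (K : Set ℝ) (hK : AccPt (0 : ℝ) (𝓟 K)) :
    (P.IsInfFree (fun u => (B u : Set A)) ↔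
      ∀ (l : ℕ), 0 < l → ∀ (ι : Fin l → Fin n) (a : Fin l → A),
        (∀ s, a s ∈ B (ι s)) → (∀ s t : Fin l, (s : ℕ) + 1 = (t : ℕ) → ι s ≠ ι t) →
          P.centeredMoment a =o[𝓝[K \ {0}] (0 : ℝ)] (fun t : ℝ => t ^ k)) ∧
    (P.IsInfFree (fun u => (B u : Set A)) ↔
      ∀ (l : ℕ), 0 < l → ∀ (ι : Fin l → Fin n) (a : Fin l → A),
        (∀ s, a s ∈ B (ι s)) → (∀ s t : Fin l, (s : ℕ) + 1 = (t : ℕ) → ι s ≠ ι t) →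
          ∀ i : Fin (k + 1), P.momentExpr a i = 0) ∧
    (∀ (l : ℕ), 0 < l → ∀ a : Fin l → A,
      (P.centeredMoment a =o[𝓝[K \ {0}] (0 : ℝ)] (fun t : ℝ => t ^ k) ↔
        ∀ i : Fin (k + 1), P.momentExpr a i = 0)) := by
  simp only [P.isLittleO_centeredMoment_iff hK, P.momentExpr_eq_zero_iff, P.isInfFree_iff B,
    iff_self, implies_true, and_self]

end
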